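/- Let $G=(V,E)$ be a finite simple graph with edge weights $w\in\mathbb R^E_{\ge 0}$. A fractional matching is a vector $x\in\mathbb R^E_{\ge 0}$ with $x(\delta(v))\le 1$ for all $v\in V$; it is basic if it is an extreme point of the polytope of fractional matchings, and maximum-weight if it maximizes $w^\top x$ over that polytope. A fractional $w$-vertex cover is a vector $y\in\mathbb R^V_{\ge 0}$ with $y_u+y_v\ge w_{uv}$ for all $uv\in E$; it is minimum if it minimizes $\sum_v y_v$. For a basic fractional matching $x$ let $\mathscr C(x)$ be the set of odd cycles $C$ of $G$ with $x_e=\frac12$ for all $e\in E(C)$, let $V(\mathscr C(x))=\bigcup_{C\in\mathscr C(x)}V(C)$, and let $M(x)=\{e\in E: x_e=1\}$. Let $\gamma(G)$ be the minimum of $|\mathscr C(x)|$ over all basic maximum-weight fractional matchings $x$. A path is $M$-alternating if its edges belong alternately to $M$ and to $E\setminus M$; it is valid if it starts with an $M$-exposed vertex or an edge of $M$, and ends with an $M$-exposed vertex or an edge of $M$. Given $y$, a path is tight if $y_u+y_v=w_{uv}$ for each of its edges $uv$. Complementing on $E'\subseteq E$ means replacing $x_e$ by $1-x_e$ for all $e\in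 E'$. Alternate rounding on an odd cycle $C$ at $v\in V(C)$, where $e_1,\dots,e_{2k+1}$ are the edges of $C$ in cyclic order, $e_1$ and $e_{2k+1}$ being the two incident to $v$, means replacing $x_e$ by $0$ on $e_1,e_3,\dots,e_{2k+1}$ and by $1$ on $e_2,e_4,\dots,e_{2k}$. **Theorem.** Let $\hat x$ be a basic maximum-weight fractional matching and $y$ a minimum fractional $w$-vertex cover in $G$. If $|\mathscr C(\hat x)|>\gamma(G)$, then there exists 1. a vertex $v\in V(C_i)$ for some $C_i\in\mathscr C(\hat x)$ such that $y_v=0$; or 2. a tight $M(\hat x)$-alternating path $P$ from a vertex $u\in V(C_i)$ to a vertex $v\in V(C_j)$ for two different cycles $C_i,C_j\in\mathscr C(\hat x)$; or 3. a tight and valid $M(\hat x)$-alternating path $P$ from a vertex $u\in V(C_i)$ for some $C_i\in\mathscr C(\hat x)$ to a vertex $v\notin V(\mathscr C(\hat x))$ such that $y_v=0$. Furthermore, for every structure as in 1, 2 or 3 (whether or not $|\mathscr C(\hat x)|>\gamma(G)$), let $\bar x$ be obtained from $\hat x$ by, respectively: alternate rounding on $C_i$ at $v$; alternate rounding on $C_i$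 at $u$ and on $C_j$ at $v$ and complementing on $E(P)$; alternate rounding on $C_i$ at $u$ and complementing on $E(P)$. Then $\bar x$ is a basic maximum-weight fractional matching and $\mathscr C(\bar x)\subsetneq\mathscr C(\hat x)$. -/

import Mathlib

namespace FractionalMatching

section LinearPrograms

variable {V : Type*} [Fintype V] [DecidableEq V] (G : SimpleGraph V) [DecidableRel G.Adj]

/-- The fractional matching polytope: all `x : E → ℝ` with `x ≥ 0` and `x(δ(v)) ≤ 1` for every
vertex `v`, where `δ(v)` is the set of edges incident to `v`. -/
def fractionalMatchings : Set (G.edgeSet → ℝ) :=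
  {x | (∀ e, 0 ≤ x e) ∧
    ∀ v, ∑ e ∈ Finset.univ.filter (fun e : G.edgeSet => v ∈ (e : Sym2 V)), x e ≤ 1}

/-- The optimal solutions of the linear program `max {wᵀx : x a fractional matching}`. -/
def maxFractionalMatchings (w : G.edgeSet → ℝ) : Set (G.edgeSet → ℝ) :=
  {x | x ∈ fractionalMatchings G ∧
    ∀ x' ∈ fractionalMatchings G, ∑ e, w e * x' e ≤ ∑ e, w e * x e}

/-- The basic maximum-weight fractional matchings. The basic feasible solutions of a linear
program are the extreme points of its feasible region. -/
def basicMaxFractionalMatchings (w : G.edgeSet → ℝ) : Set (G.edgeSet → ℝ) :=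
  {x | x ∈ (fractionalMatchings G).extremePoints ℝ ∧ x ∈ maxFractionalMatchings G w}

end LinearPrograms

section Covers

variable {V : Type*} (G : SimpleGraph V)

/-- The fractional `w`-vertex covers: all `y ≥ 0` with `y_u + y_v ≥ w_{uv}` for every edge. -/
def fractionalCovers (w : G.edgeSet → ℝ) : Set (V → ℝ) :=
  {y | (∀ v, 0 ≤ y v) ∧ ∀ (u v : V) (h : G.Adj u v), w ⟨s(u, v), h⟩ ≤ y u + y v}

/-- The fractional `w`-vertex covers `y` of minimum value `1ᵀy`. -/
def minFractionalCovers [Fintype V] (w : G.edgeSet → ℝ) : Set (V → ℝ) :=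
  {y | y ∈ fractionalCovers G w ∧ ∀ y' ∈ fractionalCovers G w, ∑ v, y v ≤ ∑ v, y' v}

end Covers

section Support

variable {V : Type*} [DecidableEq V] {G : SimpleGraph V}

/-- `c`, a closed walk at `v`, runs once around the cycle of `G` whose edge set is `C`. -/
def Traverses {v : V} (c : G.Walk v v) (C : Finset (Sym2 V)) : Prop :=
  c.IsCycle ∧ c.edges.toFinset = C

/-- `𝒞(x)`: the odd cycles of `G` (given by their edge sets) all of whose edges have
value `1/2`. -/
def oddCycles (x : G.edgeSet → ℝ) : Set (Finset (Sym2 V)) :=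
  {C | (∃ (v : V) (c : G.Walk v v), Traverses c C) ∧ Odd C.card ∧
    ∀ e : G.edgeSet, (e : Sym2 V) ∈ C → x e = 1 / 2}

/-- The vertex set of the cycle with edge set `C`. -/
def cycleVertices (C : Finset (Sym2 V)) : Set V := {v | ∃ e ∈ C, v ∈ e}

/-- `M(x)`: the edges of value `1`. -/
def matchedEdges (x : G.edgeSet → ℝ) : Set (Sym2 V) :=
  {e | ∃ h : e ∈ G.edgeSet, x ⟨e, h⟩ = 1}

/-- A cycle of `G` can be traversed starting from any of its vertices. -/
theorem exists_traverses {C : Finset (Sym2 V)} {u v : V} {c : G.Walk u u}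
    (hc : Traverses c C) (hv : v ∈ cycleVertices C) :
    ∃ d : G.Walk v v, Traverses d C := by
  obtain ⟨e, he, hve⟩ := hv
  obtain ⟨h1, rfl⟩ := hc
  have hs : v ∈ c.support := by
    rw [List.mem_toFinset] at he
    induction e with
    | _ a b =>
      rcases Sym2.mem_iff.1 hve with rfl | rfl
      · exact c.fst_mem_support_of_mem_edges he
      · exact c.snd_mem_support_of_mem_edges he
  refine ⟨c.rotate v hs, h1.rotate hs, ?_⟩
  ext f
  simp only [List.mem_toFinset]
  exact (c.rotate_edges v hs).mem_iff

end Support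

/-- `γ(G)`: the least number of odd cycles of a basic maximum-weight fractional matching. -/
noncomputable def gamma {V : Type*} [Fintype V] [DecidableEq V] (G : SimpleGraph V)
    [DecidableRel G.Adj] (w : G.edgeSet → ℝ) : ℕ :=
  sInf ((fun x => (oddCycles x).ncard) '' basicMaxFractionalMatchings G w)

section Paths

variable {V : Type*} {G : SimpleGraph V}

/-- The edges of the walk belong alternately to `M` and to its complement. -/
def Alternating (M : Set (Sym2 V)) {u v : V} (p : G.Walk u v) : Prop :=
  p.edges.IsChain (fun e f => e ∈ M ↔ f ∉ M)

/-- No edge of `M` is incident to `v`. -/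
def Exposed (M : Set (Sym2 V)) (v : V) : Prop := ∀ e ∈ M, v ∉ e

/-- The walk starts with an `M`-exposed vertex or an edge of `M`, and ends with an `M`-exposed
vertex or an edge of `M`. -/
def Valid (M : Set (Sym2 V)) {u v : V} (p : G.Walk u v) : Prop :=
  (Exposed M u ∨ ∃ e ∈ p.edges.head?, e ∈ M) ∧ (Exposed M v ∨ ∃ e ∈ p.edges.getLast?, e ∈ M)

/-- Every edge `ab` of the walk is tight: `y_a + y_b = w_{ab}`. -/
def Tight (w : G.edgeSet → ℝ) (y : V → ℝ) {u v : V} (p : G.Walk u v) : Prop :=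
  ∀ (a b : V) (h : G.Adj a b), s(a, b) ∈ p.edges → y a + y b = w ⟨s(a, b), h⟩

end Paths

section Operations

variable {V : Type*} [DecidableEq V] {G : SimpleGraph V}

/-- Complementing on the edges of a walk: `x_e` becomes `1 - x_e` there. -/
def complementOn {u v : V} (p : G.Walk u v) (x : G.edgeSet → ℝ) : G.edgeSet → ℝ :=
  fun e => if (e : Sym2 V) ∈ p.edges then 1 - x e else x e

/-- Alternate rounding along the closed walk `c = (e₁, …, e₂ₖ₊₁)` at `v`: the edges
`e₁, e₃, …, e₂ₖ₊₁` get value `0`, the edges `e₂, e₄, …, e₂ₖ` get value `1`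
(positions in the list are counted from `0`). -/
def alternateRound {v : V} (c : G.Walk v v) (x : G.edgeSet → ℝ) : G.edgeSet → ℝ :=
  fun e => if (e : Sym2 V) ∈ c.edges then
    (if Even (c.edges.idxOf (e : Sym2 V)) then 0 else 1) else x e

end Operations

section Structures

variable {V : Type*} [DecidableEq V] {G : SimpleGraph V}

/-- `v` is a vertex of the odd cycle `C ∈ 𝒞(x)` and `y_v = 0`. -/
def ZeroOnCycle (x : G.edgeSet → ℝ) (y : V → ℝ) (C : Finset (Sym2 V)) (v : V) : Prop :=
  C ∈ oddCycles x ∧ v ∈ cycleVertices C ∧ y v = 0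

/-- `P` is a tight `M(x)`-alternating path which connects two different odd cycles
`C, D ∈ 𝒞(x)`. -/
def CycleToCycle (w : G.edgeSet → ℝ) (x : G.edgeSet → ℝ) (y : V → ℝ) (C D : Finset (Sym2 V))
    {u v : V} (P : G.Walk u v) : Prop :=
  C ∈ oddCycles x ∧ D ∈ oddCycles x ∧ C ≠ D ∧ u ∈ cycleVertices C ∧ v ∈ cycleVertices D ∧
    P.IsPath ∧ Alternating (matchedEdges x) P ∧ Tight w y P

/-- `P` is a tight and valid `M(x)`-alternating path which connects an odd cycle `C ∈ 𝒞(x)` and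
a vertex `v` with `y_v = 0` which lies on no cycle of `𝒞(x)`. -/
def CycleToZero (w : G.edgeSet → ℝ) (x : G.edgeSet → ℝ) (y : V → ℝ) (C : Finset (Sym2 V))
    {u v : V} (P : G.Walk u v) : Prop :=
  C ∈ oddCycles x ∧ u ∈ cycleVertices C ∧ (∀ D ∈ oddCycles x, v ∉ cycleVertices D) ∧ y v = 0 ∧
    P.IsPath ∧ Alternating (matchedEdges x) P ∧ Valid (matchedEdges x) P ∧ Tight w y P

end Structures

end FractionalMatching

open FractionalMatching

/-!
By linear programming duality, a fractional matching and a cover are both optimal exactly when they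
satisfy complementary slackness, and the basic fractional matchings are those whose support consists
of edges of value `1` and of vertex-disjoint odd cycles of value `1/2` (Balinski). Alternate
rounding on an odd cycle exposes one vertex of it, and complementing on a tight alternating path
matches that vertex and frees at most one vertex `v`, which has `y_v = 0`: hence every such exchange
preserves slackness, and it removes the cycles that it rounds.

For the existence of an exchange, suppose that `y` vanishes nowhere on the odd cycles of `x`, and
let `x'` be a basic optimum with `γ(G)` odd cycles. Round all odd cycles of `x` and of `x'` to get
matchings `z` and `z'`. Then `z` exposes a vertex with `y ≠ 0` for each odd cycle of `x`, and `z'`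
exposes at most one such vertex for each odd cycle of `x'`, so there are more of them for `z`. Each
of them is an end of a path component of the symmetric difference of `z` and `z'`, hence for one of
them the other end of its component is not exposed by `z'` with `y ≠ 0`. After the last vertex of
this component on the odd cycle of `x` it starts from, it runs either into another odd cycle of `x`
or up to its other end, at which `y` then vanishes.
-/

namespace FractionalMatching

section Farkas

variable {𝕜 E ι : Type*} [Field 𝕜] [AddCommGroup E] [Module 𝕜 E]

/-- The map `z ↦ z + f z • d`. If `f d = -1`, it is the projection onto the kernel of `f`
along `d`. -/
def projKer (f : E →ₗ[𝕜] 𝕜) (d : E) : E →ₗ[𝕜] E := LinearMap.id + f.smulRight d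

theorem apply_projKer (f g : E →ₗ[𝕜] 𝕜) (d z : E) : g (projKer f d z) = g z + f z * g d := by
  simp [projKer]

theorem apply_projKer_self {f : E →ₗ[𝕜] 𝕜} {d : E} (hd : f d = -1) (z : E) :
    f (projKer f d z) = 0 := by
  rw [apply_projKer, hd]; ring

variable [LinearOrder 𝕜]

theorem exists_nonneg_sum_insert [DecidableEq ι] {s : Finset ι} {k : ι} (hk : k ∉ s) (f : ι → E)
    {b : 𝕜} (hb : 0 ≤ b) {c : ι → 𝕜} (hc : ∀ i, 0 ≤ c i) :
    ∃ c' : ι → 𝕜, (∀ i, 0 ≤ c' i) ∧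
      ∑ i ∈ insert k s, c' i • f i = b • f k + ∑ i ∈ s, c i • f i := by
  refine ⟨Function.update c k b, fun i => ?_, ?_⟩
  · obtain rfl | hi := eq_or_ne i k <;> simp [*]
  · rw [Finset.sum_insert hk, Function.update_self]
    congr 1
    exact Finset.sum_congr rfl fun i hi => by
      rw [Function.update_of_ne (ne_of_mem_of_not_mem hi hk)]

variable [IsStrictOrderedRing 𝕜]

theorem farkas (s : Finset ι) (f : ι → E →ₗ[𝕜] 𝕜) (g : E →ₗ[𝕜] 𝕜)
    (h : ∀ z, (∀ i ∈ s, 0 ≤ f i z) → 0 ≤ g z) :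
    ∃ c : ι → 𝕜, (∀ i, 0 ≤ c i) ∧ ∑ i ∈ s, c i • f i = g := by
  classical
  induction s using Finset.induction_on generalizing f g with
  | empty =>
    refine ⟨0, fun _ => le_rfl, LinearMap.ext fun z => ?_⟩
    have hneg : 0 ≤ g (-z) := h _ (by simp)
    rw [map_neg] at hneg
    simpa using le_antisymm (h z (by simp)) (neg_nonneg.1 hneg)
  | insert k s hk ih =>
    by_cases hs : ∀ z, (∀ i ∈ s, 0 ≤ f i z) → 0 ≤ g z
    · obtain ⟨c, hc, hsum⟩ := ih f g hs
      obtain ⟨c', hc', hsum'⟩ := exists_nonneg_sum_insert hk f le_rfl hc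
      exact ⟨c', hc', by rw [hsum', hsum, zero_smul, zero_add]⟩
    push Not at hs
    obtain ⟨d, hd, hgd, hkd⟩ : ∃ d, (∀ i ∈ s, 0 ≤ f i d) ∧ g d ≤ 0 ∧ f k d = -1 := by
      obtain ⟨d, hd, hgd⟩ := hs
      have hkd : f k d < 0 := by
        by_contra! hkd
        exact hgd.not_ge (h d (Finset.forall_mem_insert _ _ _ |>.2 ⟨hkd, hd⟩))
      have ht : 0 ≤ (-f k d)⁻¹ := by simpa using hkd.le
      refine ⟨(-f k d)⁻¹ • d, fun i hi => ?_, ?_, ?_⟩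
      · simpa using mul_nonneg ht (hd i hi)
      · simpa using mul_nonpos_of_nonneg_of_nonpos ht hgd.le
      · rw [map_smul, smul_eq_mul, inv_neg, neg_mul, inv_mul_cancel₀ hkd.ne]
    -- on the kernel of `f k` the constraints in `s` alone force `g` to be nonnegative
    obtain ⟨c, hc, hsum⟩ := ih (fun i => f i ∘ₗ projKer (f k) d) (g ∘ₗ projKer (f k) d)
      fun z hz => h _ (Finset.forall_mem_insert _ _ _ |>.2 ⟨(apply_projKer_self hkd z).ge, hz⟩)
    have hb : 0 ≤ ∑ i ∈ s, c i * f i d - g d :=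
      sub_nonneg.2 (hgd.trans (Finset.sum_nonneg fun i hi => mul_nonneg (hc i) (hd i hi)))
    obtain ⟨c', hc', hsum'⟩ := exists_nonneg_sum_insert hk f hb hc
    refine ⟨c', hc', hsum'.trans (LinearMap.ext fun z => ?_)⟩
    have hz := LinearMap.congr_fun hsum z
    simp only [LinearMap.comp_apply, LinearMap.sum_apply, LinearMap.smul_apply, smul_eq_mul,
      apply_projKer, mul_add, Finset.sum_add_distrib, mul_left_comm _ (f k z),
      ← Finset.mul_sum] at hz
    simp only [LinearMap.add_apply, LinearMap.sum_apply, LinearMap.smul_apply, smul_eq_mul]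
    linear_combination hz

end Farkas

section EdgeVectors

variable {V : Type*} {G : SimpleGraph V}

/-- Extension by zero of an edge vector to all unordered pairs of vertices. -/
noncomputable def extendZero (x : G.edgeSet → ℝ) : Sym2 V → ℝ :=
  Function.extend Subtype.val x 0

@[simp] theorem extendZero_coe (x : G.edgeSet → ℝ) (e : G.edgeSet) :
    extendZero x e = x e :=
  Subtype.val_injective.extend_apply x 0 e

theorem extendZero_mk (x : G.edgeSet → ℝ) {e : Sym2 V} (h : e ∈ G.edgeSet) :
    extendZero x e = x ⟨e, h⟩ :=
  extendZero_coe x ⟨e, h⟩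

/-- The sum `y_u + y_v` of the values of `y` at the two ends of `uv`, which a cover bounds below by
`w_{uv}`. -/
def edgeSum (y : V → ℝ) : Sym2 V → ℝ :=
  Sym2.lift ⟨fun u v => y u + y v, fun u v => add_comm (y u) (y v)⟩

@[simp] theorem edgeSum_mk (y : V → ℝ) (u v : V) : edgeSum y s(u, v) = y u + y v := rfl

theorem le_edgeSum_of_mem_fractionalCovers {w : G.edgeSet → ℝ} {y : V → ℝ}
    (hy : y ∈ fractionalCovers G w) (e : G.edgeSet) : w e ≤ edgeSum y e := by
  obtain ⟨⟨u, v⟩, he⟩ := e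
  exact hy.2 u v he

variable [Fintype V] [DecidableEq V]

theorem edgeSum_eq_sum_ite (y : V → ℝ) (e : G.edgeSet) :
    edgeSum y e = ∑ v, if v ∈ (e : Sym2 V) then y v else 0 := by
  obtain ⟨⟨a, b⟩, he⟩ := e
  have hab : a ≠ b := G.ne_of_adj he
  change y a + y b = ∑ v, if v ∈ s(a, b) then y v else 0
  rw [← Finset.sum_filter, ← Finset.sum_pair hab]
  congr 1
  ext v
  simp

variable [DecidableRel G.Adj]

/-- The load `x(δ(v))` of the vertex `v`, as a linear map in `x`. -/
def load : (G.edgeSet → ℝ) →ₗ[ℝ] V → ℝ :=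
  LinearMap.pi fun v => ∑ e ∈ Finset.univ.filter (fun e : G.edgeSet => v ∈ (e : Sym2 V)),
    LinearMap.proj e

theorem load_apply (x : G.edgeSet → ℝ) (v : V) :
    load x v = ∑ e ∈ Finset.univ.filter (fun e : G.edgeSet => v ∈ (e : Sym2 V)), x e := by
  simp [load]

theorem mem_fractionalMatchings_iff {x : G.edgeSet → ℝ} :
    x ∈ fractionalMatchings G ↔ (∀ e, 0 ≤ x e) ∧ ∀ v, load x v ≤ 1 := by
  simp only [load_apply]; rfl

theorem load_apply_eq_sum_ite (x : G.edgeSet → ℝ) (v : V) :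
    load x v = ∑ e : G.edgeSet, if v ∈ (e : Sym2 V) then x e else 0 := by
  rw [load_apply, Finset.sum_filter]

theorem load_single (e : G.edgeSet) (r : ℝ) (v : V) :
    load (Pi.single e r) v = if v ∈ (e : Sym2 V) then r else 0 := by
  rw [load_apply_eq_sum_ite, Finset.sum_eq_single e (fun f _ hf => by simp [hf]) (by simp),
    Pi.single_eq_same]

theorem sum_mul_load (x : G.edgeSet → ℝ) (y : V → ℝ) :
    ∑ v, y v * load x v = ∑ e : G.edgeSet, edgeSum y e * x e := by
  simp_rw [load_apply_eq_sum_ite, edgeSum_eq_sum_ite, Finset.mul_sum, Finset.sum_mul]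
  rw [Finset.sum_comm]
  simp only [mul_ite, ite_mul, mul_zero, zero_mul]

theorem sum_le_load {x : G.edgeSet → ℝ} (hx : ∀ e, 0 ≤ x e) {v : V} {s : Finset G.edgeSet}
    (hs : ∀ e ∈ s, v ∈ (e : Sym2 V)) : ∑ e ∈ s, x e ≤ load x v := by
  rw [load_apply]
  exact Finset.sum_le_sum_of_subset_of_nonneg (fun e he => by simpa using hs e he)
    fun e _ _ => hx e

theorem le_load {x : G.edgeSet → ℝ} (hx : ∀ e, 0 ≤ x e) {v : V} {e : G.edgeSet}
    (he : v ∈ (e : Sym2 V)) : x e ≤ load x v := by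
  simpa using sum_le_load hx (s := {e}) (by simpa using he)

theorem add_le_load {x : G.edgeSet → ℝ} (hx : ∀ e, 0 ≤ x e) {v : V} {e f : G.edgeSet}
    (hef : e ≠ f) (he : v ∈ (e : Sym2 V)) (hf : v ∈ (f : Sym2 V)) : x e + x f ≤ load x v := by
  rw [← Finset.sum_pair hef]
  exact sum_le_load (s := {e, f}) hx (by simp [he, hf])

theorem load_eq_add {x : G.edgeSet → ℝ} {v : V} {e f : G.edgeSet} (hef : e ≠ f)
    (he : v ∈ (e : Sym2 V)) (hf : v ∈ (f : Sym2 V))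
    (h : ∀ g : G.edgeSet, v ∈ (g : Sym2 V) → x g ≠ 0 → g = e ∨ g = f) :
    load x v = x e + x f := by
  rw [load_apply, ← Finset.sum_pair hef]
  refine (Finset.sum_subset (fun g hg => ?_) fun g hg hg' => ?_).symm
  · simp only [Finset.mem_insert, Finset.mem_singleton] at hg
    rcases hg with rfl | rfl <;> simpa
  · by_contra h0
    exact hg' (by simpa using h g (by simpa using hg) h0)

end EdgeVectors

section Duality

variable {V : Type*} [Fintype V] [DecidableEq V] {G : SimpleGraph V} [DecidableRel G.Adj]
  {w x : G.edgeSet → ℝ} {y : V → ℝ}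

/-- The left-hand sides of the constraints of the homogenized linear program, in the variables
`(z, t)`: `z_e ≥ 0`, `t ≥ 0`, and `t - z(δ(v)) ≥ 0`. -/
def homogenizedConstraint :
    G.edgeSet ⊕ Option V → ((G.edgeSet → ℝ) × ℝ) →ₗ[ℝ] ℝ :=
  Sum.elim (fun e => LinearMap.proj e ∘ₗ LinearMap.fst ℝ _ _) fun o =>
    o.elim (LinearMap.snd ℝ _ _) fun v =>
      LinearMap.snd ℝ _ _ - LinearMap.proj v ∘ₗ load ∘ₗ LinearMap.fst ℝ _ _

theorem sum_mul_homogenizedConstraint (c : G.edgeSet ⊕ Option V → ℝ) (z : G.edgeSet → ℝ) (t : ℝ) :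
    ∑ i, c i * homogenizedConstraint i (z, t) = ∑ e, c (.inl e) * z e +
      (c (.inr none) * t + ∑ v, c (.inr (some v)) * (t - load z v)) := by
  simp [homogenizedConstraint, Fintype.sum_sum_type, Fintype.sum_option]

theorem sum_mul_le_of_homogenized (hx : x ∈ maxFractionalMatchings G w) {z : G.edgeSet → ℝ} {t : ℝ}
    (hz : ∀ e, 0 ≤ z e) (ht : 0 ≤ t) (hzt : ∀ v, load z v ≤ t) :
    ∑ e, w e * z e ≤ (∑ e, w e * x e) * t := by
  obtain rfl | ht := ht.eq_or_lt
  · have hz0 : z = 0 := by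
      ext ⟨⟨a, b⟩, he⟩
      exact ((le_load hz (Sym2.mem_mk_left a b)).trans (hzt a)).antisymm (hz _)
    simp [hz0]
  · have hmem : t⁻¹ • z ∈ fractionalMatchings G :=
      mem_fractionalMatchings_iff.2 ⟨fun e => mul_nonneg (inv_nonneg.2 ht.le) (hz e), fun v => by
        rw [map_smul, Pi.smul_apply, smul_eq_mul, inv_mul_le_one₀ ht]
        exact hzt v⟩
    have hle := hx.2 _ hmem
    simp only [Pi.smul_apply, smul_eq_mul, mul_left_comm _ t⁻¹, ← Finset.mul_sum] at hle
    rwa [inv_mul_le_iff₀ ht, mul_comm] at hle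

theorem exists_cover_sum_le (hx : x ∈ maxFractionalMatchings G w) :
    ∃ y ∈ fractionalCovers G w, ∑ v, y v ≤ ∑ e, w e * x e := by
  set p := ∑ e, w e * x e
  obtain ⟨c, hc, hsum⟩ := farkas Finset.univ homogenizedConstraint
    (p • LinearMap.snd ℝ (G.edgeSet → ℝ) ℝ -
      (∑ e, w e • LinearMap.proj e) ∘ₗ LinearMap.fst ℝ (G.edgeSet → ℝ) ℝ) <| by
    rintro ⟨z, t⟩ h
    have hle : ∑ e, w e * z e ≤ p * t := sum_mul_le_of_homogenized hx
      (fun e => h (.inl e) (Finset.mem_univ _)) (h (.inr none) (Finset.mem_univ _))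
      fun v => sub_nonneg.1 (h (.inr (some v)) (Finset.mem_univ _))
    simpa using hle
  have hdual : ∀ (z : G.edgeSet → ℝ) (t : ℝ), ∑ e, c (.inl e) * z e +
      (c (.inr none) * t + ∑ v, c (.inr (some v)) * (t - load z v)) =
        p * t - ∑ e, w e * z e := fun z t => by
    rw [← sum_mul_homogenizedConstraint]
    simpa using LinearMap.congr_fun hsum (z, t)
  refine ⟨fun v => c (.inr (some v)), ⟨fun v => hc _, fun a b hab => ?_⟩, ?_⟩
  · have h := hdual (Pi.single ⟨s(a, b), hab⟩ 1) 0
    simp only [zero_sub, mul_neg, mul_zero, zero_add, Finset.sum_neg_distrib, sum_mul_load,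
      Pi.single_apply, mul_ite, mul_one, Finset.sum_ite_eq', Finset.mem_univ, if_true,
      edgeSum_mk] at h
    linarith [hc (.inl ⟨s(a, b), hab⟩)]
  · have h := hdual 0 1
    simp only [Pi.zero_apply, map_zero, mul_zero, mul_one, sub_zero, Finset.sum_const_zero,
      zero_add] at h
    linarith [hc (.inr none)]

/-- `x` and `y` satisfy the complementary slackness conditions. -/
def Slack (w x : G.edgeSet → ℝ) (y : V → ℝ) : Prop :=
  (∀ e, x e ≠ 0 → edgeSum y e = w e) ∧ ∀ v, y v ≠ 0 → load x v = 1

theorem slack_of_optimal (hx : x ∈ maxFractionalMatchings G w)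
    (hy : y ∈ minFractionalCovers G w) : Slack w x y := by
  obtain ⟨y', hy', hle⟩ := exists_cover_sum_le hx
  have hyx : ∑ v, y v ≤ ∑ e, w e * x e := (hy.2 y' hy').trans hle
  obtain ⟨hx0, hx1⟩ := mem_fractionalMatchings_iff.1 hx.1
  have hedge : ∀ e ∈ Finset.univ, w e * x e ≤ edgeSum y e * x e := fun e _ =>
    mul_le_mul_of_nonneg_right (le_edgeSum_of_mem_fractionalCovers hy.1 e) (hx0 e)
  have hvertex : ∀ v ∈ Finset.univ, y v * load x v ≤ y v := fun v _ =>
    mul_le_of_le_one_right (hy.1.1 v) (hx1 v)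
  have hsum_edge := Finset.sum_le_sum hedge
  have hsum_vertex := Finset.sum_le_sum hvertex
  have hedge_eq := (Finset.sum_eq_sum_iff_of_le hedge).1 (by linarith [sum_mul_load x y])
  have hvertex_eq := (Finset.sum_eq_sum_iff_of_le hvertex).1 (by linarith [sum_mul_load x y])
  exact ⟨fun e he => (mul_right_cancel₀ he (hedge_eq e (Finset.mem_univ e))).symm,
    fun v hv => (mul_eq_left₀ hv).1 (hvertex_eq v (Finset.mem_univ v))⟩

theorem Slack.sum_eq (h : Slack w x y) : ∑ e, w e * x e = ∑ v, y v :=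
  calc ∑ e, w e * x e = ∑ e : G.edgeSet, edgeSum y e * x e :=
        Finset.sum_congr rfl fun e _ => by
          obtain he | he := eq_or_ne (x e) 0
          · rw [he, mul_zero, mul_zero]
          · rw [h.1 e he]
    _ = ∑ v, y v * load x v := (sum_mul_load x y).symm
    _ = ∑ v, y v := Finset.sum_congr rfl fun v _ => by
          obtain hv | hv := eq_or_ne (y v) 0
          · rw [hv, zero_mul]
          · rw [h.2 v hv, mul_one]

theorem Slack.optimal (h : Slack w x y) (hx : x ∈ fractionalMatchings G)
    (hy : y ∈ fractionalCovers G w) : x ∈ maxFractionalMatchings G w := by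
  refine ⟨hx, fun z hz => ?_⟩
  obtain ⟨hz0, hz1⟩ := mem_fractionalMatchings_iff.1 hz
  calc ∑ e, w e * z e ≤ ∑ e : G.edgeSet, edgeSum y e * z e :=
        Finset.sum_le_sum fun e _ =>
          mul_le_mul_of_nonneg_right (le_edgeSum_of_mem_fractionalCovers hy e) (hz0 e)
    _ = ∑ v, y v * load z v := (sum_mul_load z y).symm
    _ ≤ ∑ v, y v := Finset.sum_le_sum fun v _ => mul_le_of_le_one_right (hy.1 v) (hz1 v)
    _ = ∑ e, w e * x e := h.sum_eq.symm

end Duality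

section AlternatingWalks

theorem isChain_neg_of_idxOf {α : Type*} [DecidableEq α] {l : List α} (hl : l.Nodup) {ψ : ℕ → ℝ}
    (hψ : ∀ i, ψ (i + 1) = -ψ i) : l.IsChain (fun a b => ψ (l.idxOf b) = -ψ (l.idxOf a)) := by
  rw [List.isChain_iff_getElem]
  intro i hi
  rw [hl.idxOf_getElem, hl.idxOf_getElem, hψ]

theorem getElem_eq_neg_one_pow_mul_of_isChain {α : Type*} {φ : α → ℝ} {l : List α}
    (h : l.IsChain (fun a b => φ b = -φ a)) (i : ℕ) (hi : i < l.length) :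
    φ l[i] = (-1 : ℝ) ^ i * φ l[0] := by
  induction i with
  | zero => simp
  | succ k ih => rw [List.isChain_iff_getElem.1 h k hi, ih (by omega), pow_succ]; ring

variable {V : Type*} {G : SimpleGraph V} {u v : V} {p : G.Walk u v} {φ : Sym2 V → ℝ}

theorem getElem_edges_zero (hp : 0 < p.edges.length) : p.edges[0] = s(u, p.snd) := by
  simp [SimpleGraph.Walk.getElem_edges]

theorem penultimate_edge_eq_neg_one_pow_mul (hn : ¬p.Nil)
    (hφ : p.edges.IsChain (fun e f => φ f = -φ e)) :
    φ s(p.penultimate, v) = (-1) ^ (p.length - 1) * φ s(u, p.snd) := by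
  have hpos : 0 < p.length := SimpleGraph.Walk.not_nil_iff_lt_length.1 hn
  have h := getElem_eq_neg_one_pow_mul_of_isChain hφ (p.length - 1) (by simpa using hpos)
  rwa [getElem_edges_zero, SimpleGraph.Walk.getElem_edges, Nat.sub_add_cancel hpos,
    SimpleGraph.Walk.getVert_length] at h

theorem eq_zero_of_fst_edge_eq_zero (hφ : p.edges.IsChain (fun e f => φ f = -φ e))
    (h0 : φ s(u, p.snd) = 0) {e : Sym2 V} (he : e ∈ p.edges) : φ e = 0 := by
  obtain ⟨i, hi, rfl⟩ := List.mem_iff_getElem.1 he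
  rw [getElem_eq_neg_one_pow_mul_of_isChain hφ i hi, getElem_edges_zero, h0, mul_zero]

variable [Fintype V] [DecidableEq V] [DecidableRel G.Adj]

theorem load_ite_mem_edges_cons {a : V} (h : G.Adj a u) (ha : s(a, u) ∉ p.edges) (t : V) :
    load (fun e : G.edgeSet => if (e : Sym2 V) ∈ (p.cons h).edges then φ e else 0) t =
      (if t ∈ s(a, u) then φ s(a, u) else 0) +
        load (fun e : G.edgeSet => if (e : Sym2 V) ∈ p.edges then φ e else 0) t := by
  have hsplit : (fun e : G.edgeSet => if (e : Sym2 V) ∈ (p.cons h).edges then φ e else 0) =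
      Pi.single ⟨s(a, u), h⟩ (φ s(a, u)) +
        fun e : G.edgeSet => if (e : Sym2 V) ∈ p.edges then φ e else 0 := by
    ext e
    obtain rfl | he := eq_or_ne e ⟨s(a, u), h⟩
    · simp [ha]
    · simp [he, mt Subtype.ext he]
  rw [hsplit, map_add, Pi.add_apply, load_single]

/-- The contributions to all vertices other than the two ends cancel. -/
theorem load_ite_mem_edges_of_isChain (hp : p.IsTrail) (hn : ¬p.Nil)
    (hφ : p.edges.IsChain (fun e f => φ f = -φ e)) (t : V) :
    load (fun e : G.edgeSet => if (e : Sym2 V) ∈ p.edges then φ e else 0) t =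
      (if t = u then φ s(u, p.snd) else 0) + (if t = v then φ s(p.penultimate, v) else 0) := by
  induction p with
  | nil => exact absurd SimpleGraph.Walk.Nil.nil hn
  | @cons a b c h q ih =>
    obtain ⟨hq, hab⟩ := SimpleGraph.Walk.isTrail_cons _ _ |>.1 hp
    rw [load_ite_mem_edges_cons h hab]
    have hne := h.ne
    cases q with
    | nil =>
      simp only [SimpleGraph.Walk.edges_nil, List.not_mem_nil, if_false, Sym2.mem_iff,
        SimpleGraph.Walk.snd_cons, SimpleGraph.Walk.penultimate_cons_nil]
      change _ + load (0 : G.edgeSet → ℝ) t = _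
      rw [map_zero, Pi.zero_apply]
      by_cases h1 : t = a <;> by_cases h2 : t = b <;> simp_all
    | @cons _ d _ h' q' =>
      simp only [SimpleGraph.Walk.edges_cons, List.isChain_cons_cons] at hφ
      have hload := ih hq SimpleGraph.Walk.not_nil_cons hφ.2
      simp only [SimpleGraph.Walk.snd_cons] at hload
      rw [hload, hφ.1]
      simp only [SimpleGraph.Walk.snd_cons, SimpleGraph.Walk.penultimate_cons_cons, Sym2.mem_iff]
      by_cases h1 : t = a <;> by_cases h2 : t = b <;> simp_all

end AlternatingWalks

section OddCycles

variable {V : Type*} [DecidableEq V] {G : SimpleGraph V} {x : G.edgeSet → ℝ}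
  {C D : Finset (Sym2 V)} {u v : V}

theorem Traverses.mem_edges_iff {c : G.Walk u u} (hc : Traverses c C) {e : Sym2 V} :
    e ∈ c.edges ↔ e ∈ C := by
  rw [← hc.2, List.mem_toFinset]

theorem Traverses.mem_edgeSet {c : G.Walk u u} (hc : Traverses c C) {e : Sym2 V} (he : e ∈ C) :
    e ∈ G.edgeSet :=
  c.edges_subset_edgeSet (hc.mem_edges_iff.2 he)

theorem Traverses.card_eq {c : G.Walk u u} (hc : Traverses c C) : C.card = c.length := by
  rw [← hc.2, List.toFinset_card_of_nodup hc.1.1.1.edges_nodup, SimpleGraph.Walk.length_edges]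

theorem Traverses.mem_iff_of_mem {c : G.Walk v v} (hc : Traverses c C) {e : Sym2 V} (he : v ∈ e) :
    e ∈ C ↔ e = s(v, c.snd) ∨ e = s(v, c.penultimate) := by
  obtain ⟨b, rfl⟩ := he
  have hb : b ∈ c.toSubgraph.neighborSet v ↔ b = c.snd ∨ b = c.penultimate := by
    rw [hc.1.neighborSet_toSubgraph_endpoint, Set.mem_insert_iff, Set.mem_singleton_iff]
  rw [← hc.mem_edges_iff, ← SimpleGraph.Walk.adj_toSubgraph_iff_mem_edges, Sym2.congr_right,
    Sym2.congr_right]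
  exact hb

theorem Traverses.exists_pair {c : G.Walk u u} (hc : Traverses c C) (hv : v ∈ cycleVertices C) :
    ∃ e f : G.edgeSet, e ≠ f ∧ v ∈ (e : Sym2 V) ∧ v ∈ (f : Sym2 V) ∧ (e : Sym2 V) ∈ C ∧
      (f : Sym2 V) ∈ C ∧ ∀ g : G.edgeSet, v ∈ (g : Sym2 V) → (g : Sym2 V) ∈ C → g = e ∨ g = f := by
  obtain ⟨d, hd⟩ := exists_traverses hc hv
  have he : s(v, d.snd) ∈ C := (hd.mem_iff_of_mem (Sym2.mem_mk_left _ _)).2 (.inl rfl)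
  have hf : s(v, d.penultimate) ∈ C := (hd.mem_iff_of_mem (Sym2.mem_mk_left _ _)).2 (.inr rfl)
  refine ⟨⟨_, hd.mem_edgeSet he⟩, ⟨_, hd.mem_edgeSet hf⟩, fun h => ?_, Sym2.mem_mk_left _ _,
    Sym2.mem_mk_left _ _, he, hf, fun g hvg hg => ?_⟩
  · exact hd.1.snd_ne_penultimate (Sym2.congr_right.1 (congrArg Subtype.val h))
  · simpa only [Subtype.ext_iff] using (hd.mem_iff_of_mem hvg).1 hg

theorem Traverses.eq_or_eq_of_mem {c : G.Walk u u} (hc : Traverses c C) {e f g : G.edgeSet}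
    (hef : e ≠ f) (hve : v ∈ (e : Sym2 V)) (hvf : v ∈ (f : Sym2 V)) (hvg : v ∈ (g : Sym2 V))
    (he : (e : Sym2 V) ∈ C) (hf : (f : Sym2 V) ∈ C) (hg : (g : Sym2 V) ∈ C) : g = e ∨ g = f := by
  obtain ⟨e', f', -, -, -, -, -, h⟩ := hc.exists_pair ⟨e, he, hve⟩
  grind

theorem Traverses.mem_cycleVertices {c : G.Walk v v} (hc : Traverses c C) : v ∈ cycleVertices C :=
  ⟨_, (hc.mem_iff_of_mem (Sym2.mem_mk_left _ _)).2 (.inl rfl), Sym2.mem_mk_left v c.snd⟩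

theorem Traverses.subset_of_forall {c : G.Walk v v} (hc : Traverses c C)
    (hv : v ∈ cycleVertices D) (h : ∀ e ∈ C, ∀ a ∈ e, a ∈ cycleVertices D → e ∈ D) : C ⊆ D := by
  have hedge : ∀ i < c.length, c.getVert i ∈ cycleVertices D →
      s(c.getVert i, c.getVert (i + 1)) ∈ D := fun i hi hiD =>
    h _ (hc.mem_edges_iff.1 (SimpleGraph.Walk.getElem_edges (p := c) (i := i) (by simpa using hi) ▸
      List.getElem_mem _)) _ (Sym2.mem_mk_left _ _) hiD
  have hvert : ∀ i ≤ c.length, c.getVert i ∈ cycleVertices D := by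
    intro i
    induction i with
    | zero => exact fun _ => by rwa [SimpleGraph.Walk.getVert_zero]
    | succ k ih => exact fun hk => ⟨_, hedge k hk (ih (by omega)), Sym2.mem_mk_right _ _⟩
  intro e he
  obtain ⟨i, hi, rfl⟩ := List.mem_iff_getElem.1 (hc.mem_edges_iff.2 he)
  rw [SimpleGraph.Walk.getElem_edges]
  rw [SimpleGraph.Walk.length_edges] at hi
  exact hedge i hi (hvert i hi.le)

theorem exists_pair_of_mem_oddCycles (hC : C ∈ oddCycles x) (hv : v ∈ cycleVertices C) :
    ∃ e f : G.edgeSet, e ≠ f ∧ v ∈ (e : Sym2 V) ∧ v ∈ (f : Sym2 V) ∧ (e : Sym2 V) ∈ C ∧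
      (f : Sym2 V) ∈ C ∧ x e = 1 / 2 ∧ x f = 1 / 2 := by
  obtain ⟨⟨u, c, hc⟩, -, hhalf⟩ := hC
  obtain ⟨e, f, hef, hve, hvf, he, hf, -⟩ := hc.exists_pair hv
  exact ⟨e, f, hef, hve, hvf, he, hf, hhalf e he, hhalf f hf⟩

variable [Fintype V] [DecidableRel G.Adj]

theorem Traverses.load_eq_add {c : G.Walk u u} (hc : Traverses c C) {z : G.edgeSet → ℝ}
    (hsupp : ∀ g : G.edgeSet, v ∈ (g : Sym2 V) → z g ≠ 0 → (g : Sym2 V) ∈ C) {e f : G.edgeSet}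
    (hef : e ≠ f) (hve : v ∈ (e : Sym2 V)) (hvf : v ∈ (f : Sym2 V)) (he : (e : Sym2 V) ∈ C)
    (hf : (f : Sym2 V) ∈ C) : load z v = z e + z f :=
  FractionalMatching.load_eq_add hef hve hvf fun g hvg hg =>
    hc.eq_or_eq_of_mem hef hve hvf hvg he hf (hsupp g hvg hg)

/-- Consecutive edges of the cycle have values adding up to `1`, so `z - 1/2` changes sign from each
edge to the next; on an odd cycle it therefore vanishes. -/
theorem Traverses.eq_half_of_odd {c : G.Walk u u} (hc : Traverses c C) (hodd : Odd C.card)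
    {z : G.edgeSet → ℝ} (hload : ∀ v ∈ cycleVertices C, load z v = 1)
    (hsupp : ∀ v ∈ cycleVertices C, ∀ g : G.edgeSet, v ∈ (g : Sym2 V) → z g ≠ 0 →
      (g : Sym2 V) ∈ C) {e : G.edgeSet} (he : (e : Sym2 V) ∈ C) : z e = 1 / 2 := by
  set φ : Sym2 V → ℝ := fun e => extendZero z e - 1 / 2 with hφ
  have hneg : ∀ {a e f}, a ∈ e → a ∈ f → e ≠ f → e ∈ C → f ∈ C → φ f = -φ e := by
    intro a e f hae haf hef he hf
    have hsum := hc.load_eq_add (hsupp a ⟨e, he, hae⟩) (e := ⟨e, hc.mem_edgeSet he⟩)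
      (f := ⟨f, hc.mem_edgeSet hf⟩) (fun h => hef (congrArg Subtype.val h)) hae haf he hf
    rw [hload a ⟨e, he, hae⟩] at hsum
    simp only [hφ, extendZero_mk z (hc.mem_edgeSet he), extendZero_mk z (hc.mem_edgeSet hf)]
    linarith
  have hchain : c.edges.IsChain (fun e f => φ f = -φ e) := by
    refine List.isChain_iff_getElem.2 fun i hi => hneg (a := c.getVert (i + 1)) ?_ ?_ ?_
      (hc.mem_edges_iff.1 (List.getElem_mem _)) (hc.mem_edges_iff.1 (List.getElem_mem _))
    · simp [SimpleGraph.Walk.getElem_edges]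
    · simp [SimpleGraph.Walk.getElem_edges]
    · exact fun h => absurd (hc.1.1.1.edges_nodup.getElem_inj_iff.1 h) (by omega)
  have hclose : φ s(c.penultimate, u) = -φ s(u, c.snd) :=
    hneg (Sym2.mem_mk_left u c.snd) (Sym2.mem_mk_right _ u)
      (fun h => hc.1.snd_ne_penultimate (Sym2.congr_right.1 (h.trans Sym2.eq_swap)))
      (hc.mem_edges_iff.1 (SimpleGraph.Walk.mk_start_snd_mem_edges hc.1.not_nil))
      (hc.mem_edges_iff.1 (SimpleGraph.Walk.mk_penultimate_end_mem_edges hc.1.not_nil))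
  have heven : Even (c.length - 1) := by
    rw [hc.card_eq] at hodd
    exact Nat.Odd.sub_odd hodd odd_one
  rw [penultimate_edge_eq_neg_one_pow_mul hc.1.not_nil hchain, heven.neg_one_pow] at hclose
  have hzero : φ e = 0 :=
    eq_zero_of_fst_edge_eq_zero hchain (by linarith) (hc.mem_edges_iff.2 he)
  simpa [hφ, sub_eq_zero] using hzero

end OddCycles

section BasicFractionalMatchings

open Filter Topology

variable {V : Type*} [Fintype V] [DecidableEq V] {G : SimpleGraph V} [DecidableRel G.Adj]
  {x : G.edgeSet → ℝ} {C D : Finset (Sym2 V)} {v : V}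

theorem le_one_of_mem_fractionalMatchings (hx : x ∈ fractionalMatchings G) (e : G.edgeSet) :
    x e ≤ 1 := by
  obtain ⟨hx0, hx1⟩ := mem_fractionalMatchings_iff.1 hx
  obtain ⟨⟨a, b⟩, he⟩ := e
  exact (le_load hx0 (Sym2.mem_mk_left a b)).trans (hx1 a)

theorem eq_zero_of_eq_one (hx : x ∈ fractionalMatchings G) {e f : G.edgeSet} (hxe : x e = 1)
    (hfe : f ≠ e) (he : v ∈ (e : Sym2 V)) (hf : v ∈ (f : Sym2 V)) : x f = 0 := by
  obtain ⟨hx0, hx1⟩ := mem_fractionalMatchings_iff.1 hx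
  linarith [add_le_load hx0 hfe hf he, hx1 v, hx0 f]

theorem load_eq_one_of_eq_one (hx : x ∈ fractionalMatchings G) {e : G.edgeSet} (hxe : x e = 1)
    (he : v ∈ (e : Sym2 V)) : load x v = 1 := by
  obtain ⟨hx0, hx1⟩ := mem_fractionalMatchings_iff.1 hx
  exact (hx1 v).antisymm (hxe ▸ le_load hx0 he)

theorem load_eq_one_of_mem_oddCycles (hx : x ∈ fractionalMatchings G) (hC : C ∈ oddCycles x)
    (hv : v ∈ cycleVertices C) : load x v = 1 := by
  obtain ⟨hx0, hx1⟩ := mem_fractionalMatchings_iff.1 hx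
  obtain ⟨e, f, hef, hve, hvf, -, -, hxe, hxf⟩ := exists_pair_of_mem_oddCycles hC hv
  linarith [add_le_load hx0 hef hve hvf, hx1 v]

theorem mem_of_mem_oddCycles (hx : x ∈ fractionalMatchings G) (hC : C ∈ oddCycles x)
    (hv : v ∈ cycleVertices C) {g : G.edgeSet} (hg : v ∈ (g : Sym2 V)) (hxg : x g ≠ 0) :
    (g : Sym2 V) ∈ C := by
  obtain ⟨hx0, hx1⟩ := mem_fractionalMatchings_iff.1 hx
  obtain ⟨e, f, hef, hve, hvf, he, hf, hxe, hxf⟩ := exists_pair_of_mem_oddCycles hC hv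
  by_contra hgC
  have heg : e ≠ g := fun h => hgC (h ▸ he)
  have hfg : f ≠ g := fun h => hgC (h ▸ hf)
  have hsum : ∑ a ∈ {e, f, g}, x a ≤ load x v := sum_le_load hx0 (by simp [hve, hvf, hg])
  rw [Finset.sum_insert (by simp [hef, heg]), Finset.sum_pair hfg, hxe, hxf] at hsum
  exact hxg (le_antisymm (by linarith [hx1 v]) (hx0 g))

theorem subset_of_mem_oddCycles (hx : x ∈ fractionalMatchings G) (hC : C ∈ oddCycles x)
    (hD : D ∈ oddCycles x) (hvC : v ∈ cycleVertices C) (hvD : v ∈ cycleVertices D) : C ⊆ D := by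
  obtain ⟨⟨u, c, hc⟩, -, hhalf⟩ := hC
  obtain ⟨d, hd⟩ := exists_traverses hc hvC
  refine hd.subset_of_forall hvD fun e he a ha haD => ?_
  refine mem_of_mem_oddCycles (g := ⟨e, hd.mem_edgeSet he⟩) hx hD haD ha ?_
  rw [hhalf _ he]
  norm_num

theorem eq_of_mem_oddCycles (hx : x ∈ fractionalMatchings G) (hC : C ∈ oddCycles x)
    (hD : D ∈ oddCycles x) (hvC : v ∈ cycleVertices C) (hvD : v ∈ cycleVertices D) : C = D :=
  (subset_of_mem_oddCycles hx hC hD hvC hvD).antisymm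
    (subset_of_mem_oddCycles hx hD hC hvD hvC)

/-- A fractional matching whose support consists of edges of value `1` and of odd cycles all of
whose edges have value `1/2`. By Balinski's theorem these are the basic fractional matchings. -/
def IsOddCycleMatching (x : G.edgeSet → ℝ) : Prop :=
  x ∈ fractionalMatchings G ∧
    ∀ e : G.edgeSet, x e = 0 ∨ x e = 1 ∨ ∃ C ∈ oddCycles x, (e : Sym2 V) ∈ C

theorem eq_of_add_mul_eq {a b p q r : ℝ} (ha : 0 < a) (hb : 0 ≤ b) (hab : a + b = 1) (hp : p ≤ r)
    (hq : q ≤ r) (h : a * p + b * q = r) : p = r := by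
  refine hp.antisymm (le_of_mul_le_mul_left ?_ ha)
  have hbq := mul_le_mul_of_nonneg_left hq hb
  linear_combination hbq + r * hab - h

theorem IsOddCycleMatching.mem_extremePoints (hx : IsOddCycleMatching x) :
    x ∈ (fractionalMatchings G).extremePoints ℝ := by
  refine mem_extremePoints_iff_left.2 ⟨hx.1, fun z hz z' hz' hseg => ?_⟩
  obtain ⟨a, b, ha, hb, hab, rfl⟩ := hseg
  obtain ⟨hz0, hz1⟩ := mem_fractionalMatchings_iff.1 hz
  obtain ⟨hz0', hz1'⟩ := mem_fractionalMatchings_iff.1 hz'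
  have hzero : ∀ e, (a • z + b • z') e = 0 → z e = 0 := fun e he =>
    neg_eq_zero.1 <| eq_of_add_mul_eq ha hb.le hab (neg_nonpos.2 (hz0 e))
      (neg_nonpos.2 (hz0' e)) (by
        simp only [Pi.add_apply, Pi.smul_apply, smul_eq_mul] at he
        linarith)
  have hload : ∀ v, load (a • z + b • z') v = 1 → load z v = 1 := fun v hv =>
    eq_of_add_mul_eq ha hb.le hab (hz1 v) (hz1' v) (by simpa using hv)
  ext e
  obtain he | he | ⟨C, hC, he⟩ := hx.2 e
  · rw [he, hzero e he]
  · rw [he]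
    exact eq_of_add_mul_eq ha hb.le hab (le_one_of_mem_fractionalMatchings hz e)
      (le_one_of_mem_fractionalMatchings hz' e) he
  · have hhalf := hC.2.2 e he
    obtain ⟨⟨u, c, hc⟩, hodd, -⟩ := id hC
    rw [hhalf]
    exact hc.eq_half_of_odd hodd (fun v hv => hload v (load_eq_one_of_mem_oddCycles hx.1 hC hv))
      (fun v hv g hg hzg => mem_of_mem_oddCycles hx.1 hC hv hg (mt (hzero g) hzg)) he

theorem eventually_nonneg_add_mul {a b : ℝ} (ha : 0 ≤ a) (hab : a = 0 → b = 0) :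
    ∀ᶠ ε in 𝓝 (0 : ℝ), 0 ≤ a + ε * b := by
  obtain rfl | ha := ha.eq_or_lt
  · simp [hab rfl]
  · have hcont : Continuous fun ε : ℝ => a + ε * b := by fun_prop
    exact (hcont.tendsto' 0 a (by simp)).eventually (lt_mem_nhds ha) |>.mono fun _ => le_of_lt

theorem eventually_add_smul_mem_fractionalMatchings (hx : x ∈ fractionalMatchings G)
    {d : G.edgeSet → ℝ} (hd : ∀ e, x e = 0 → d e = 0) (hl : ∀ v, load x v = 1 → load d v = 0) :
    ∀ᶠ ε in 𝓝 (0 : ℝ), x + ε • d ∈ fractionalMatchings G := by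
  obtain ⟨hx0, hx1⟩ := mem_fractionalMatchings_iff.1 hx
  filter_upwards [eventually_all.2 fun e => eventually_nonneg_add_mul (hx0 e) (hd e),
    eventually_all.2 fun v => eventually_nonneg_add_mul (b := -load d v) (sub_nonneg.2 (hx1 v))
      fun h => neg_eq_zero.2 (hl v (by linarith))] with ε hedge hvertex
  refine mem_fractionalMatchings_iff.2 ⟨hedge, fun v => ?_⟩
  have h := hvertex v
  simp only [map_add, map_smul, Pi.add_apply, Pi.smul_apply, smul_eq_mul]
  linarith

theorem eq_zero_of_mem_extremePoints (hx : x ∈ (fractionalMatchings G).extremePoints ℝ)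
    {d : G.edgeSet → ℝ} (hd : ∀ e, x e = 0 → d e = 0) (hl : ∀ v, load x v = 1 → load d v = 0) :
    d = 0 := by
  have hplus := eventually_add_smul_mem_fractionalMatchings hx.1 hd hl
  have hminus : ∀ᶠ ε in 𝓝 (0 : ℝ), x + (-ε) • d ∈ fractionalMatchings G :=
    (continuous_neg.tendsto' (0 : ℝ) 0 neg_zero).eventually hplus
  obtain ⟨ε, ⟨hp, hm⟩, hε⟩ :=
    (((hplus.and hminus).filter_mono nhdsWithin_le_nhds).and
      (self_mem_nhdsWithin (s := {0}ᶜ))).exists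
  have hmid : x ∈ openSegment ℝ (x + ε • d) (x + (-ε) • d) :=
    ⟨1 / 2, 1 / 2, by norm_num, by norm_num, by norm_num, by module⟩
  have hεd : x + ε • d = x := (mem_extremePoints_iff_left.1 hx).2 _ hp _ hm hmid
  exact (smul_eq_zero.1 (add_eq_left.1 hεd)).resolve_left hε

end BasicFractionalMatchings

section Balinski

variable {V : Type*} {G : SimpleGraph V} {x : G.edgeSet → ℝ} {v : V}

/-- The graph of the edges of fractional value. -/
def fracGraph (x : G.edgeSet → ℝ) : SimpleGraph V :=
  .fromEdgeSet {e | extendZero x e ∈ Set.Ioo 0 1}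

theorem mem_edgeSet_fracGraph {e : Sym2 V} :
    e ∈ (fracGraph x).edgeSet ↔ ∃ h : e ∈ G.edgeSet, x ⟨e, h⟩ ∈ Set.Ioo 0 1 := by
  rw [fracGraph, SimpleGraph.edgeSet_fromEdgeSet]
  constructor
  · rintro ⟨he, -⟩
    have heG : e ∈ G.edgeSet := by
      by_contra heG
      have hzero : extendZero x e = 0 := Function.extend_apply' _ _ _ (by simpa using heG)
      exact he.1.ne' hzero
    exact ⟨heG, extendZero_mk x heG ▸ he⟩
  · exact fun ⟨heG, he⟩ => ⟨by rwa [Set.mem_ofPred_eq, extendZero_mk x heG],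
      G.not_isDiag_of_mem_edgeSet heG⟩

theorem fracGraph_le : fracGraph x ≤ G :=
  SimpleGraph.edgeSet_subset_edgeSet.1 fun _ he => (mem_edgeSet_fracGraph.1 he).1

variable [Fintype V] [DecidableEq V] [DecidableRel G.Adj]

theorem load_eq_zero_of_forall_notMem_Ioo (hv : v ∉ (fracGraph x).support) {d : G.edgeSet → ℝ}
    (hd : ∀ e, x e ∉ Set.Ioo 0 1 → d e = 0) : load d v = 0 := by
  rw [load_apply]
  refine Finset.sum_eq_zero fun e he => hd e fun hfrac => hv ?_
  obtain ⟨⟨e, heG⟩, b, rfl⟩ := e, (Finset.mem_filter.1 he).2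
  exact ⟨b, mem_edgeSet_fracGraph.2 ⟨heG, hfrac⟩⟩

open Classical in
/-- Otherwise the loads of the saturated vertices would fail to determine a vector supported on the
fractional edges. -/
theorem card_edgeFinset_fracGraph_le (hx : x ∈ (fractionalMatchings G).extremePoints ℝ) :
    (fracGraph x).edgeFinset.card ≤
      (Finset.univ.filter fun v => v ∈ (fracGraph x).support ∧ load x v = 1).card := by
  let Φ : (G.edgeSet → ℝ) →ₗ[ℝ] ({e // x e ∉ Set.Ioo 0 1} → ℝ) ×
      ({v // v ∈ (fracGraph x).support ∧ load x v = 1} → ℝ) :=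
    (LinearMap.funLeft ℝ ℝ Subtype.val).prod (LinearMap.funLeft ℝ ℝ Subtype.val ∘ₗ load)
  have hinj : Function.Injective Φ := by
    refine (injective_iff_map_eq_zero Φ).2 fun d hd => ?_
    have hedge : ∀ e, x e ∉ Set.Ioo 0 1 → d e = 0 := fun e he =>
      congrFun (congrArg Prod.fst hd) ⟨e, he⟩
    refine eq_zero_of_mem_extremePoints hx (fun e he => hedge e (by simp [he])) fun v hv => ?_
    by_cases hsupp : v ∈ (fracGraph x).support
    · exact congrFun (congrArg Prod.snd hd) ⟨v, hsupp, hv⟩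
    · exact load_eq_zero_of_forall_notMem_Ioo hsupp hedge
  have hrank := LinearMap.finrank_le_finrank_of_injective hinj
  have hedges : (fracGraph x).edgeFinset.card = Fintype.card {e // x e ∈ Set.Ioo 0 1} := by
    rw [← SimpleGraph.card_edgeSet]
    exact Fintype.card_congr ((Equiv.subtypeEquivRight fun e => mem_edgeSet_fracGraph).trans
      (Equiv.subtypeSubtypeEquivSubtypeExists (· ∈ G.edgeSet) (x · ∈ Set.Ioo 0 1)).symm)
  rw [Module.finrank_prod, Module.finrank_fintype_fun_eq_card, Module.finrank_fintype_fun_eq_card,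
    Module.finrank_fintype_fun_eq_card, Fintype.card_subtype_compl] at hrank
  have hcompl := Fintype.card_subtype_le fun e : G.edgeSet => x e ∈ Set.Ioo 0 1
  rw [hedges, ← Fintype.card_subtype]
  omega

theorem exists_ne_mem_Ioo (hx : x ∈ fractionalMatchings G) (hv : load x v = 1) {e : G.edgeSet}
    (he : x e ∈ Set.Ioo 0 1) (hve : v ∈ (e : Sym2 V)) :
    ∃ f ≠ e, v ∈ (f : Sym2 V) ∧ x f ∈ Set.Ioo 0 1 := by
  obtain ⟨hx0, hx1⟩ := mem_fractionalMatchings_iff.1 hx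
  obtain ⟨f, hfe, hvf, hf⟩ : ∃ f ≠ e, v ∈ (f : Sym2 V) ∧ x f ≠ 0 := by
    by_contra! hzero
    rw [load_apply, Finset.sum_eq_single_of_mem e (by simpa using hve) fun f hf hfe =>
      hzero f hfe (Finset.mem_filter.1 hf).2] at hv
    exact he.2.ne hv
  have hpos : 0 < x f := (hx0 f).lt_of_ne' hf
  exact ⟨f, hfe, hvf, hpos, by linarith [add_le_load hx0 hfe hvf hve, he.1]⟩

open Classical in
theorem two_le_degree_fracGraph (hx : x ∈ fractionalMatchings G) (hv : load x v = 1)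
    (hsupp : v ∈ (fracGraph x).support) : 2 ≤ (fracGraph x).degree v := by
  obtain ⟨a, ha⟩ := SimpleGraph.mem_support _ |>.1 hsupp
  obtain ⟨haG, hfrac⟩ := mem_edgeSet_fracGraph (e := s(v, a)).1 ha
  obtain ⟨⟨f, hfG⟩, hfe, ⟨b, rfl⟩, hf⟩ := exists_ne_mem_Ioo hx hv hfrac (Sym2.mem_mk_left v a)
  refine Finset.one_lt_card.2 ⟨a, by simpa using ha, b, ?_, ?_⟩
  · exact (SimpleGraph.mem_neighborFinset _ _ _).2 (mem_edgeSet_fracGraph.2 ⟨hfG, hf⟩)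
  · rintro rfl
    exact hfe rfl

open Classical in
/-- Both sides of the handshake identity for the fractional edges are pinned down by
`card_edgeFinset_fracGraph_le`. -/
theorem load_eq_one_and_degree_fracGraph_eq_two
    (hx : x ∈ (fractionalMatchings G).extremePoints ℝ) (hv : v ∈ (fracGraph x).support) :
    load x v = 1 ∧ (fracGraph x).degree v = 2 := by
  have hle : ∀ u ∈ (fracGraph x).support.toFinset,
      (if load x u = 1 then 2 else 0) ≤ (fracGraph x).degree u := by
    intro u hu
    split_ifs with hload
    · exact two_le_degree_fracGraph hx.1 hload (Set.mem_toFinset.1 hu)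
    · exact Nat.zero_le _
  have hsum : ∑ u ∈ (fracGraph x).support.toFinset, (fracGraph x).degree u ≤
      ∑ u ∈ (fracGraph x).support.toFinset, if load x u = 1 then 2 else 0 := by
    have hcard := card_edgeFinset_fracGraph_le hx
    rw [Finset.filter_and] at hcard
    rw [SimpleGraph.sum_degrees_support_eq_twice_card_edges, ← Finset.sum_filter,
      Finset.sum_const, smul_eq_mul, mul_comm]
    refine Nat.mul_le_mul_right 2 (hcard.trans (Finset.card_le_card fun u hu => ?_))
    simpa using hu
  have hpos : 0 < (fracGraph x).degree v := by
    obtain ⟨a, ha⟩ := hv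
    exact (SimpleGraph.degree_pos_iff_exists_adj _ _).2 ⟨a, ha⟩
  have heq := (Finset.sum_eq_sum_iff_of_le hle).1 ((Finset.sum_le_sum hle).antisymm hsum) v
    (Set.mem_toFinset.2 hv)
  grind

theorem fracGraph_isCycles (hx : x ∈ (fractionalMatchings G).extremePoints ℝ) :
    (fracGraph x).IsCycles := by
  classical
  rintro v hv
  rw [← Nat.card_coe_set_eq, Nat.card_eq_fintype_card, SimpleGraph.card_neighborSet_eq_degree]
  exact (load_eq_one_and_degree_fracGraph_eq_two hx hv).2

/-- If the cycle were even, adding and subtracting multiples of its alternating `±1` vector would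
move `x` in both directions within the polytope. -/
theorem odd_length_of_isCycle (hx : x ∈ (fractionalMatchings G).extremePoints ℝ) {u : V}
    {c : G.Walk u u} (hc : c.IsCycle) (hzero : ∀ e : G.edgeSet, ↑e ∈ c.edges → x e ≠ 0) :
    Odd c.length := by
  by_contra heven
  rw [Nat.not_odd_iff_even] at heven
  have hchain := isChain_neg_of_idxOf hc.1.1.edges_nodup (ψ := fun i => (-1 : ℝ) ^ i)
    fun i => by rw [pow_succ, mul_neg_one]
  have hpred : Odd (c.length - 1) :=
    Nat.Even.sub_odd (by linarith [hc.three_le_length]) heven odd_one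
  have hd := eq_zero_of_mem_extremePoints hx
    (d := fun e => if ↑e ∈ c.edges then (-1 : ℝ) ^ c.edges.idxOf (e : Sym2 V) else 0)
    (fun e he => if_neg fun hmem => hzero e hmem he) fun v _ => by
      rw [load_ite_mem_edges_of_isChain hc.1.1 hc.not_nil hchain,
        penultimate_edge_eq_neg_one_pow_mul hc.not_nil hchain, hpred.neg_one_pow]
      split_ifs <;> ring
  have hfst := congrFun hd ⟨_, c.edges_subset_edgeSet (c.mk_start_snd_mem_edges hc.not_nil)⟩
  simp [c.mk_start_snd_mem_edges hc.not_nil] at hfst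

theorem mem_Ioo_of_ne_zero (hx : x ∈ fractionalMatchings G) {e f : G.edgeSet}
    (he : x e ∈ Set.Ioo 0 1) (hve : v ∈ (e : Sym2 V)) (hvf : v ∈ (f : Sym2 V)) (hf : x f ≠ 0) :
    x f ∈ Set.Ioo 0 1 := by
  refine ⟨((mem_fractionalMatchings_iff.1 hx).1 f).lt_of_ne' hf,
    (le_one_of_mem_fractionalMatchings hx f).lt_of_ne fun hone => ?_⟩
  obtain rfl | hef := eq_or_ne e f
  · exact he.2.ne hone
  · exact he.1.ne' (eq_zero_of_eq_one hx hone hef hvf hve)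

theorem exists_mem_oddCycles_of_mem_Ioo (hx : x ∈ (fractionalMatchings G).extremePoints ℝ)
    {e : G.edgeSet} (he : x e ∈ Set.Ioo 0 1) : ∃ C ∈ oddCycles x, (e : Sym2 V) ∈ C := by
  classical
  have hcycles := fracGraph_isCycles hx
  obtain ⟨⟨a, b⟩, heG⟩ := e
  have hadj : (fracGraph x).Adj a b := mem_edgeSet_fracGraph.2 ⟨heG, he⟩
  obtain ⟨u, p, hp, hep⟩ := SimpleGraph.adj_and_reachable_delete_edges_iff_exists_cycle.1
    ⟨hadj, hcycles.reachable_deleteEdges hadj⟩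
  have hc : Traverses (p.mapLe fracGraph_le) p.edges.toFinset :=
    ⟨(SimpleGraph.Walk.isCycle_mapLe _).2 hp,
      congrArg List.toFinset (SimpleGraph.Walk.edges_mapLe_eq_edges _ _)⟩
  have hfrac : ∀ g : G.edgeSet, ↑g ∈ p.edges.toFinset → x g ∈ Set.Ioo 0 1 := fun g hg =>
    (mem_edgeSet_fracGraph.1 (p.edges_subset_edgeSet (List.mem_toFinset.1 hg))).2
  have hodd : Odd p.edges.toFinset.card := by
    rw [hc.card_eq]
    exact odd_length_of_isCycle hx hc.1 fun g hg => (hfrac g (hc.mem_edges_iff.1 hg)).1.ne'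
  refine ⟨p.edges.toFinset, ⟨⟨u, _, hc⟩, hodd, fun g hg => ?_⟩, List.mem_toFinset.2 hep⟩
  refine hc.eq_half_of_odd hodd (fun v ⟨f, hf, hvf⟩ => ?_) (fun v ⟨f, hf, hvf⟩ h hvh hxh => ?_) hg
  · obtain ⟨b, rfl⟩ := hvf
    exact (load_eq_one_and_degree_fracGraph_eq_two hx
      ⟨b, p.edges_subset_edgeSet (List.mem_toFinset.1 hf)⟩).1
  · have hh := mem_Ioo_of_ne_zero hx.1 (hfrac ⟨f, hc.mem_edgeSet hf⟩ hf) hvf hvh hxh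
    obtain ⟨b, rfl⟩ := hvf
    obtain ⟨⟨h, hhG⟩, d, rfl⟩ := h, hvh
    have hpf := p.adj_toSubgraph_iff_mem_edges.2 (List.mem_toFinset.1 hf)
    exact List.mem_toFinset.2 (p.adj_toSubgraph_iff_mem_edges.1
      ((hp.adj_toSubgraph_iff_of_isCycles hcycles hpf.fst_mem d).2
        (mem_edgeSet_fracGraph.2 ⟨hhG, hh⟩)))

theorem mem_extremePoints_iff_isOddCycleMatching :
    x ∈ (fractionalMatchings G).extremePoints ℝ ↔ IsOddCycleMatching x := by
  refine ⟨fun hx => ⟨hx.1, fun e => ?_⟩, IsOddCycleMatching.mem_extremePoints⟩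
  obtain he | he := (mem_fractionalMatchings_iff.1 hx.1).1 e |>.eq_or_lt
  · exact .inl he.symm
  · obtain h | h := (le_one_of_mem_fractionalMatchings hx.1 e).eq_or_lt
    · exact .inr (.inl h)
    · exact .inr (.inr (exists_mem_oddCycles_of_mem_Ioo hx ⟨he, h⟩))

end Balinski

section AlternateRounding

variable {V : Type*} [DecidableEq V] {G : SimpleGraph V} {x : G.edgeSet → ℝ}
  {C : Finset (Sym2 V)} {v : V} {c : G.Walk v v} {e : G.edgeSet}

theorem alternateRound_of_notMem (hc : Traverses c C) (he : (e : Sym2 V) ∉ C) :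
    alternateRound c x e = x e :=
  if_neg (mt hc.mem_edges_iff.1 he)

theorem alternateRound_of_mem (hc : Traverses c C) (he : (e : Sym2 V) ∈ C) :
    alternateRound c x e = 0 ∨ alternateRound c x e = 1 := by
  rw [alternateRound, if_pos (hc.mem_edges_iff.2 he)]
  exact (ite_eq_or_eq _ _ _)

theorem alternateRound_eq_of_zero_or_one (hC : C ∈ oddCycles x) (hc : Traverses c C)
    (he : x e = 0 ∨ x e = 1) : alternateRound c x e = x e := by
  refine alternateRound_of_notMem hc fun heC => ?_
  rw [hC.2.2 e heC] at he
  norm_num at he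

theorem ne_zero_of_alternateRound_ne_zero (hC : C ∈ oddCycles x) (hc : Traverses c C)
    (he : alternateRound c x e ≠ 0) : x e ≠ 0 := fun hxe =>
  he ((alternateRound_eq_of_zero_or_one hC hc (.inl hxe)).trans hxe)

variable [Fintype V] [DecidableRel G.Adj]

theorem load_alternateRound (hx : x ∈ fractionalMatchings G) (hC : C ∈ oddCycles x)
    (hc : Traverses c C) (t : V) :
    load (alternateRound c x) t = if t = v then 0 else load x t := by
  have hchain := isChain_neg_of_idxOf hc.1.1.1.edges_nodup
    (ψ := fun i => if Even i then -(1 / 2 : ℝ) else 1 / 2)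
    fun i => by by_cases h : Even i <;> simp [Nat.even_add_one, h]
  have hsplit : alternateRound c x = x + fun e : G.edgeSet => if (e : Sym2 V) ∈ c.edges then
      (if Even (c.edges.idxOf (e : Sym2 V)) then -(1 / 2 : ℝ) else 1 / 2) else 0 := by
    ext e
    simp only [alternateRound, Pi.add_apply]
    split_ifs with he
    · rw [hC.2.2 e (hc.mem_edges_iff.1 he)]; norm_num
    · rw [hC.2.2 e (hc.mem_edges_iff.1 he)]; norm_num
    · rw [add_zero]
  have hfst : c.edges.idxOf s(v, c.snd) = 0 := by
    rw [← getElem_edges_zero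
      (by simpa using SimpleGraph.Walk.not_nil_iff_lt_length.1 hc.1.not_nil),
      hc.1.1.1.edges_nodup.idxOf_getElem]
  have heven : Even (c.length - 1) := Nat.Odd.sub_odd (hc.card_eq ▸ hC.2.1) odd_one
  rw [hsplit, map_add, Pi.add_apply, load_ite_mem_edges_of_isChain hc.1.1.1 hc.1.not_nil hchain,
    penultimate_edge_eq_neg_one_pow_mul hc.1.not_nil hchain, heven.neg_one_pow, hfst]
  obtain rfl | htv := eq_or_ne t v
  · rw [load_eq_one_of_mem_oddCycles hx hC hc.mem_cycleVertices]
    norm_num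
  · simp only [if_neg htv, add_zero]

theorem oddCycles_alternateRound (hx : x ∈ fractionalMatchings G) (hC : C ∈ oddCycles x)
    (hc : Traverses c C) : oddCycles (alternateRound c x) = oddCycles x \ {C} := by
  have hhalf : ∀ e : G.edgeSet, alternateRound c x e = 1 / 2 → (e : Sym2 V) ∉ C := by
    intro e he heC
    have h := alternateRound_of_mem (x := x) hc heC
    rw [he] at h
    norm_num at h
  ext D
  constructor
  · rintro ⟨hD, hodd, hDhalf⟩
    refine ⟨⟨hD, hodd, fun e he => ?_⟩, ?_⟩
    · rw [← alternateRound_of_notMem (x := x) hc (hhalf e (hDhalf e he)), hDhalf e he]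
    · rintro rfl
      obtain ⟨e, -, -, -, -, he, -⟩ := hc.exists_pair hc.mem_cycleVertices
      exact hhalf e (hDhalf e he) he
  · rintro ⟨hD, hDC⟩
    refine ⟨hD.1, hD.2.1, fun e he => ?_⟩
    obtain ⟨⟨a, b⟩, heG⟩ := e
    rw [alternateRound_of_notMem hc, hD.2.2 _ he]
    exact fun heC => hDC (eq_of_mem_oddCycles hx hD hC ⟨_, he, Sym2.mem_mk_left a b⟩
      ⟨_, heC, Sym2.mem_mk_left a b⟩)

theorem IsOddCycleMatching.alternateRound (hx : IsOddCycleMatching x) (hC : C ∈ oddCycles x)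
    (hc : Traverses c C) : IsOddCycleMatching (alternateRound c x) := by
  obtain ⟨hx0, hx1⟩ := mem_fractionalMatchings_iff.1 hx.1
  refine ⟨mem_fractionalMatchings_iff.2 ⟨fun e => ?_, fun t => ?_⟩, fun e => ?_⟩
  · by_cases he : (e : Sym2 V) ∈ C
    · obtain h | h := alternateRound_of_mem (x := x) hc he <;> rw [h]
      exact zero_le_one
    · rw [alternateRound_of_notMem hc he]; exact hx0 e
  · rw [load_alternateRound hx.1 hC hc]
    split_ifs
    exacts [zero_le_one, hx1 t]
  · by_cases he : (e : Sym2 V) ∈ C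
    · exact (alternateRound_of_mem hc he).imp_right .inl
    · rw [alternateRound_of_notMem hc he, oddCycles_alternateRound hx.1 hC hc]
      refine (hx.2 e).imp_right (Or.imp_right fun ⟨D, hD, heD⟩ => ⟨D, ⟨hD, ?_⟩, heD⟩)
      rintro rfl
      exact he heD

end AlternateRounding

section Complementation

variable {V : Type*} {G : SimpleGraph V} {x : G.edgeSet → ℝ} {w : G.edgeSet → ℝ} {y : V → ℝ}
  {u v : V} {p : G.Walk u v} {e : G.edgeSet}

/-- Of any two consecutive edges of the walk one has value `0` and the other has value `1`. -/
def SwitchesAlong (x : G.edgeSet → ℝ) {u v : V} (p : G.Walk u v) : Prop :=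
  p.edges.IsChain fun e f => extendZero x e = 0 ∧ extendZero x f = 1 ∨
    extendZero x e = 1 ∧ extendZero x f = 0

theorem SwitchesAlong.isChain_neg (h : SwitchesAlong x p) :
    p.edges.IsChain fun e f => 1 - 2 * extendZero x f = -(1 - 2 * extendZero x e) :=
  h.imp fun e f => by rintro (⟨he, hf⟩ | ⟨he, hf⟩) <;> rw [he, hf] <;> norm_num

theorem SwitchesAlong.zero_or_one (h : SwitchesAlong x p) (hfst : extendZero x s(u, p.snd) = 0)
    (he : (e : Sym2 V) ∈ p.edges) : x e = 0 ∨ x e = 1 := by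
  obtain ⟨i, hi, hie⟩ := List.mem_iff_getElem.1 he
  have hval := getElem_eq_neg_one_pow_mul_of_isChain h.isChain_neg i hi
  rw [getElem_edges_zero, hfst, hie, extendZero_coe] at hval
  obtain hsign | hsign := neg_one_pow_eq_or ℝ i
  · left; rw [hsign] at hval; linarith
  · right; rw [hsign] at hval; linarith

theorem Tight.edgeSum_eq (h : Tight w y p) (he : (e : Sym2 V) ∈ p.edges) :
    edgeSum y e = w e := by
  obtain ⟨⟨a, b⟩, hab⟩ := e
  exact h a b hab he

variable [DecidableEq V]

theorem mem_edges_or_ne_zero_of_complementOn_ne_zero (he : complementOn p x e ≠ 0) :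
    (e : Sym2 V) ∈ p.edges ∨ x e ≠ 0 := by
  by_contra! h
  exact he (by rw [complementOn, if_neg h.1, h.2])

theorem oddCycles_complementOn : oddCycles (complementOn p x) = oddCycles x := by
  have hhalf : ∀ e : G.edgeSet, complementOn p x e = 1 / 2 ↔ x e = 1 / 2 := by
    intro e
    rw [complementOn]
    split_ifs
    · constructor <;> intro <;> linarith
    · rfl
  simp only [oddCycles, hhalf]

theorem SwitchesAlong.alternateRound {t : V} {c : G.Walk t t} {C : Finset (Sym2 V)}
    (h : SwitchesAlong x p) (hC : C ∈ oddCycles x) (hc : Traverses c C) :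
    SwitchesAlong (alternateRound c x) p := by
  have hround : ∀ e ∈ p.edges, extendZero x e = 0 ∨ extendZero x e = 1 →
      extendZero (FractionalMatching.alternateRound c x) e = extendZero x e := fun e he hval => by
    have heG := p.edges_subset_edgeSet he
    rw [extendZero_mk _ heG] at hval ⊢
    rw [extendZero_mk _ heG]
    exact alternateRound_eq_of_zero_or_one hC hc hval
  rw [SwitchesAlong, List.isChain_iff_getElem] at h ⊢
  intro i hi
  obtain ⟨h0, h1⟩ | ⟨h1, h0⟩ := h i hi
  · exact .inl ⟨(hround _ (List.getElem_mem _) (.inl h0)).trans h0,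
      (hround _ (List.getElem_mem _) (.inr h1)).trans h1⟩
  · exact .inr ⟨(hround _ (List.getElem_mem _) (.inr h1)).trans h1,
      (hround _ (List.getElem_mem _) (.inl h0)).trans h0⟩

variable [Fintype V] [DecidableRel G.Adj]

theorem eq_zero_of_load_eq_zero (hx : x ∈ fractionalMatchings G) (hv : load x v = 0)
    (he : v ∈ (e : Sym2 V)) : x e = 0 := by
  obtain ⟨hx0, -⟩ := mem_fractionalMatchings_iff.1 hx
  exact (hv ▸ le_load hx0 he).antisymm (hx0 e)

theorem switchesAlong_of_alternating (hx : x ∈ fractionalMatchings G)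
    (hp : Alternating (matchedEdges x) p) : SwitchesAlong x p := by
  rw [SwitchesAlong, List.isChain_iff_getElem]
  intro i hi
  have he : p.edges[i] ∈ G.edgeSet := p.edges_subset_edgeSet (List.getElem_mem _)
  have hf : p.edges[i + 1] ∈ G.edgeSet := p.edges_subset_edgeSet (List.getElem_mem _)
  have hve : p.getVert (i + 1) ∈ p.edges[i] := by simp [SimpleGraph.Walk.getElem_edges]
  have hvf : p.getVert (i + 1) ∈ p.edges[i + 1] := by simp [SimpleGraph.Walk.getElem_edges]
  have halt := List.isChain_iff_getElem.1 hp i hi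
  have hne : p.edges[i] ≠ p.edges[i + 1] := fun h => by
    rw [h] at halt
    exact iff_not_self halt
  rw [extendZero_mk x he, extendZero_mk x hf]
  by_cases hmatched : p.edges[i] ∈ matchedEdges x
  · obtain ⟨_, hone⟩ := hmatched
    exact .inr ⟨hone, eq_zero_of_eq_one hx hone (mt (congrArg Subtype.val) hne.symm) hve hvf⟩
  · obtain ⟨_, hone⟩ := not_not.1 (mt halt.2 hmatched)
    exact .inl ⟨eq_zero_of_eq_one hx hone (mt (congrArg Subtype.val) hne) hvf hve, hone⟩

theorem load_complementOn (hp : p.IsTrail) (hn : ¬p.Nil) (h : SwitchesAlong x p) (t : V) :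
    load (complementOn p x) t = load x t +
      ((if t = u then 1 - 2 * extendZero x s(u, p.snd) else 0) +
        (if t = v then 1 - 2 * extendZero x s(p.penultimate, v) else 0)) := by
  have hsplit : complementOn p x = x + fun e : G.edgeSet => if (e : Sym2 V) ∈ p.edges then
      1 - 2 * extendZero x e else 0 := by
    ext e
    simp only [complementOn, Pi.add_apply, extendZero_coe]
    split_ifs <;> ring
  rw [hsplit, map_add, Pi.add_apply, load_ite_mem_edges_of_isChain hp hn h.isChain_neg]

theorem extendZero_fst_edge_eq_zero (hx : x ∈ fractionalMatchings G) (hn : ¬p.Nil)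
    (hu : load x u = 0) : extendZero x s(u, p.snd) = 0 := by
  rw [extendZero_mk x (p.adj_snd hn)]
  exact eq_zero_of_load_eq_zero hx hu (Sym2.mem_mk_left _ _)

theorem load_complementOn_of_ne (hx : x ∈ fractionalMatchings G) (hp : p.IsTrail) (hn : ¬p.Nil)
    (h : SwitchesAlong x p) (hu : load x u = 0) {t : V} (ht : t ≠ v) :
    load (complementOn p x) t = if t = u then 1 else load x t := by
  rw [load_complementOn hp hn h, if_neg ht, extendZero_fst_edge_eq_zero hx hn hu]
  split_ifs with htu
  · rw [htu, hu]; norm_num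
  · simp

theorem load_complementOn_end (hp : p.IsTrail) (huv : u ≠ v) (h : SwitchesAlong x p) :
    load (complementOn p x) v = load x v + (1 - 2 * extendZero x s(p.penultimate, v)) := by
  rw [load_complementOn hp (SimpleGraph.Walk.not_nil_of_ne huv) h, if_neg huv.symm, if_pos rfl,
    zero_add]

theorem load_complementOn_end_of_load_eq_zero (hx : x ∈ fractionalMatchings G) (hp : p.IsTrail)
    (huv : u ≠ v) (h : SwitchesAlong x p) (hv : load x v = 0) :
    load (complementOn p x) v = 1 := by
  have hn : ¬p.Nil := SimpleGraph.Walk.not_nil_of_ne huv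
  rw [load_complementOn_end hp huv h, hv, extendZero_mk x (p.adj_penultimate hn),
    eq_zero_of_load_eq_zero hx hv (Sym2.mem_mk_right _ _)]
  norm_num

theorem IsOddCycleMatching.complementOn (hx : IsOddCycleMatching x) (hp : p.IsTrail) (huv : u ≠ v)
    (h : SwitchesAlong x p) (hu : load x u = 0)
    (hv : extendZero x s(p.penultimate, v) = 1 ∨ load x v = 0) :
    IsOddCycleMatching (complementOn p x) := by
  obtain ⟨hx0, hx1⟩ := mem_fractionalMatchings_iff.1 hx.1
  have hn : ¬p.Nil := SimpleGraph.Walk.not_nil_of_ne huv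
  refine ⟨mem_fractionalMatchings_iff.2 ⟨fun e => ?_, fun t => ?_⟩, fun e => ?_⟩
  · rw [FractionalMatching.complementOn]
    split_ifs
    exacts [sub_nonneg.2 (le_one_of_mem_fractionalMatchings hx.1 e), hx0 e]
  · obtain rfl | ht := eq_or_ne t v
    · obtain hv | hv := hv
      · rw [load_complementOn_end hp huv h, hv]
        linarith [hx1 t]
      · exact (load_complementOn_end_of_load_eq_zero hx.1 hp huv h hv).le
    · rw [load_complementOn_of_ne hx.1 hp hn h hu ht]
      split_ifs
      exacts [le_rfl, hx1 t]
  · rw [oddCycles_complementOn, FractionalMatching.complementOn]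
    split_ifs with he
    · obtain hxe | hxe :=
        h.zero_or_one (extendZero_fst_edge_eq_zero hx.1 hn hu) he <;> simp [hxe]
    · exact hx.2 e

end Complementation

section Exchange

variable {V : Type*} [Fintype V] [DecidableEq V] {G : SimpleGraph V} [DecidableRel G.Adj]
  {x w : G.edgeSet → ℝ} {y : V → ℝ} {C D : Finset (Sym2 V)} {u v : V} {p : G.Walk u v}

theorem IsOddCycleMatching.load_eq_zero_of_exposed (hx : IsOddCycleMatching x)
    (hv : ∀ D ∈ oddCycles x, v ∉ cycleVertices D) (he : Exposed (matchedEdges x) v) :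
    load x v = 0 := by
  rw [load_apply]
  refine Finset.sum_eq_zero fun e hve => ?_
  rw [Finset.mem_filter_univ] at hve
  obtain h | h | ⟨D, hD, heD⟩ := hx.2 e
  · exact h
  · exact absurd hve (he e ⟨e.2, h⟩)
  · exact absurd ⟨e, heD, hve⟩ (hv D hD)

theorem IsOddCycleMatching.mem_basicMaxFractionalMatchings (hx : IsOddCycleMatching x)
    (hy : y ∈ fractionalCovers G w) (hs : Slack w x y) : x ∈ basicMaxFractionalMatchings G w :=
  ⟨hx.mem_extremePoints, hs.optimal hx.1 hy⟩

theorem last_edge_eq_one_or_load_eq_zero_of_cycleToZero (hx : IsOddCycleMatching x)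
    (h : CycleToZero w x y C p) {c : G.Walk u u} (hc : Traverses c C) :
    extendZero (alternateRound c x) s(p.penultimate, v) = 1 ∨ load (alternateRound c x) v = 0 := by
  obtain ⟨hC, hu, hv, -, -, -, ⟨-, hexposed | ⟨e, he, heG, hxe⟩⟩, -⟩ := h
  · right
    rw [load_alternateRound hx.1 hC hc, hx.load_eq_zero_of_exposed hv hexposed, ite_self]
  · left
    have hn : ¬p.Nil := SimpleGraph.Walk.not_nil_of_ne fun huv => hv C hC (huv ▸ hu)
    have hlast : s(p.penultimate, v) = e := by
      rw [SimpleGraph.Walk.mk_penultimate_end_eq_getLast_edges hn]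
      exact List.getLast_of_mem_getLast? he
    rw [hlast, extendZero_mk _ heG, alternateRound_eq_of_zero_or_one hC hc (.inr hxe), hxe]

theorem round_zeroOnCycle (hx : IsOddCycleMatching x) (hy : y ∈ fractionalCovers G w)
    (hs : Slack w x y) (h : ZeroOnCycle x y C v) {c : G.Walk v v} (hc : Traverses c C) :
    alternateRound c x ∈ basicMaxFractionalMatchings G w ∧
      oddCycles (alternateRound c x) ⊂ oddCycles x := by
  obtain ⟨hC, -, hyv⟩ := h
  refine ⟨(hx.alternateRound hC hc).mem_basicMaxFractionalMatchings hy
    ⟨fun e he => hs.1 e (ne_zero_of_alternateRound_ne_zero hC hc he), fun t ht => ?_⟩, ?_⟩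
  · rw [load_alternateRound hx.1 hC hc, if_neg (ne_of_apply_ne y (hyv ▸ ht)), hs.2 t ht]
  · rw [oddCycles_alternateRound hx.1 hC hc]
    exact Set.sdiff_singleton_ssubset.2 hC

theorem round_cycleToCycle (hx : IsOddCycleMatching x) (hy : y ∈ fractionalCovers G w)
    (hs : Slack w x y) (h : CycleToCycle w x y C D p) {c : G.Walk u u} {d : G.Walk v v}
    (hc : Traverses c C) (hd : Traverses d D) :
    complementOn p (alternateRound d (alternateRound c x)) ∈ basicMaxFractionalMatchings G w ∧
      oddCycles (complementOn p (alternateRound d (alternateRound c x))) ⊂ oddCycles x := by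
  obtain ⟨hC, hD, hCD, hu, hv, hp, halt, htight⟩ := h
  have huv : u ≠ v := by
    rintro rfl
    exact hCD (eq_of_mem_oddCycles hx.1 hC hD hu hv)
  have hxc := hx.alternateRound hC hc
  have hDc : D ∈ oddCycles (alternateRound c x) := by
    rw [oddCycles_alternateRound hx.1 hC hc]
    exact ⟨hD, hCD.symm⟩
  have hxd := hxc.alternateRound hDc hd
  have hswitch := ((switchesAlong_of_alternating hx.1 halt).alternateRound hC hc).alternateRound
    hDc hd
  have hload : ∀ t, load (alternateRound d (alternateRound c x)) t =
      if t = v then 0 else if t = u then 0 else load x t := fun t => by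
    rw [load_alternateRound hxc.1 hDc hd, load_alternateRound hx.1 hC hc]
  have hload_u : load (alternateRound d (alternateRound c x)) u = 0 := by
    rw [hload, if_neg huv, if_pos rfl]
  have hload_v : load (alternateRound d (alternateRound c x)) v = 0 := by rw [hload, if_pos rfl]
  refine ⟨(hxd.complementOn hp.isTrail huv hswitch hload_u
    (.inr hload_v)).mem_basicMaxFractionalMatchings hy ⟨fun e he => ?_, fun t ht => ?_⟩, ?_⟩
  · obtain hep | hne := mem_edges_or_ne_zero_of_complementOn_ne_zero he
    · exact htight.edgeSum_eq hep
    · exact hs.1 e (ne_zero_of_alternateRound_ne_zero hC hc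
        (ne_zero_of_alternateRound_ne_zero hDc hd hne))
  · obtain rfl | htv := eq_or_ne t v
    · exact load_complementOn_end_of_load_eq_zero hxd.1 hp.isTrail huv hswitch hload_v
    · rw [load_complementOn_of_ne hxd.1 hp.isTrail (SimpleGraph.Walk.not_nil_of_ne huv) hswitch
        hload_u htv, hload, if_neg htv, hs.2 t ht]
      exact ite_eq_left_iff.2 fun htu => if_neg htu
  · rw [oddCycles_complementOn, oddCycles_alternateRound hxc.1 hDc hd,
      oddCycles_alternateRound hx.1 hC hc]
    exact Set.sdiff_subset.trans_ssubset (Set.sdiff_singleton_ssubset.2 hC)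

theorem round_cycleToZero (hx : IsOddCycleMatching x) (hy : y ∈ fractionalCovers G w)
    (hs : Slack w x y) (h : CycleToZero w x y C p) {c : G.Walk u u} (hc : Traverses c C) :
    complementOn p (alternateRound c x) ∈ basicMaxFractionalMatchings G w ∧
      oddCycles (complementOn p (alternateRound c x)) ⊂ oddCycles x := by
  have hlast := last_edge_eq_one_or_load_eq_zero_of_cycleToZero hx h hc
  obtain ⟨hC, hu, hv, hyv, hp, halt, -, htight⟩ := h
  have huv : u ≠ v := fun h => hv C hC (h ▸ hu)
  have hxc := hx.alternateRound hC hc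
  have hswitch := (switchesAlong_of_alternating hx.1 halt).alternateRound hC hc
  have hload := load_alternateRound hx.1 hC hc
  have hload_u : load (alternateRound c x) u = 0 := by rw [hload, if_pos rfl]
  refine ⟨(hxc.complementOn hp.isTrail huv hswitch hload_u
    hlast).mem_basicMaxFractionalMatchings hy ⟨fun e he => ?_, fun t ht => ?_⟩, ?_⟩
  · obtain hep | hne := mem_edges_or_ne_zero_of_complementOn_ne_zero he
    · exact htight.edgeSum_eq hep
    · exact hs.1 e (ne_zero_of_alternateRound_ne_zero hC hc hne)
  · rw [load_complementOn_of_ne hxc.1 hp.isTrail (SimpleGraph.Walk.not_nil_of_ne huv) hswitch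
      hload_u (ne_of_apply_ne y (hyv ▸ ht)), hload, hs.2 t ht]
    exact ite_eq_left_iff.2 fun htu => if_neg htu
  · rw [oddCycles_complementOn, oddCycles_alternateRound hx.1 hC hc]
    exact Set.sdiff_singleton_ssubset.2 hC

end Exchange

section Zigzag

variable {V : Type*} {σ τ : V → V} {a b : V}

/-- The state of a zigzag along two involutions `σ` and `τ` is its current vertex together with a
flag telling which of them moves next: `τ` if the flag is `false`, and `σ` if it is `true`. -/
def zigzagStep (σ τ : V → V) (q : V × Bool) : V × Bool :=
  (bif q.2 then σ q.1 else τ q.1, !q.2)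

/-- The zigzag `a, τ a, σ (τ a), τ (σ (τ a)), …` from `a`. -/
def zigzag (σ τ : V → V) (a : V) (n : ℕ) : V :=
  ((zigzagStep σ τ)^[n] (a, false)).1

/-- The number of steps after which the zigzag from a fixed point `a` of `σ` reaches its other end:
it runs back from there, so that `(a, false)` has period twice the number of its vertices. -/
noncomputable def zigzagLength (σ τ : V → V) (a : V) : ℕ :=
  Function.minimalPeriod (zigzagStep σ τ) (a, false) / 2 - 1

theorem iterate_zigzagStep (a : V) (n : ℕ) :
    (zigzagStep σ τ)^[n] (a, false) = (zigzag σ τ a n, decide (Odd n)) := by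
  refine Prod.ext rfl ?_
  induction n with
  | zero => simp
  | succ n ih =>
    rw [Function.iterate_succ_apply']
    simp only [zigzagStep, ih, Nat.odd_add_one, decide_not]

@[simp] theorem zigzag_zero : zigzag σ τ a 0 = a := rfl

theorem zigzag_succ_of_even {n : ℕ} (hn : Even n) :
    zigzag σ τ a (n + 1) = τ (zigzag σ τ a n) := by
  rw [zigzag, Function.iterate_succ_apply', iterate_zigzagStep, zigzagStep,
    decide_eq_false (Nat.not_odd_iff_even.2 hn), cond_false]

theorem zigzag_succ_of_odd {n : ℕ} (hn : Odd n) :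
    zigzag σ τ a (n + 1) = σ (zigzag σ τ a n) := by
  rw [zigzag, Function.iterate_succ_apply', iterate_zigzagStep, zigzagStep, decide_eq_true hn,
    cond_true]

theorem zigzagStep_flip_zigzagStep (hσ : σ.Involutive) (hτ : τ.Involutive) (q : V × Bool) :
    zigzagStep σ τ (Prod.map id not (zigzagStep σ τ q)) = Prod.map id not q := by
  obtain ⟨v, _ | _⟩ := q <;> simp [zigzagStep, hσ v, hτ v]

theorem zigzagStep_injective (hσ : σ.Involutive) (hτ : τ.Involutive) :
    Function.Injective (zigzagStep σ τ) :=
  .of_comp (f := zigzagStep σ τ ∘ Prod.map id not) <| by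
    have : (zigzagStep σ τ ∘ Prod.map id not) ∘ zigzagStep σ τ = Prod.map id not :=
      funext (zigzagStep_flip_zigzagStep hσ hτ)
    rw [this]
    exact Function.injective_id.prodMap Bool.not_injective

theorem iterate_zigzagStep_flip (hσ : σ.Involutive) (hτ : τ.Involutive) (n : ℕ) (q : V × Bool) :
    (zigzagStep σ τ)^[n] (Prod.map id not ((zigzagStep σ τ)^[n] q)) = Prod.map id not q := by
  induction n with
  | zero => rfl
  | succ n ih =>
    rw [Function.iterate_succ_apply (zigzagStep σ τ) n (Prod.map id not _),
      Function.iterate_succ_apply', zigzagStep_flip_zigzagStep hσ hτ, ih]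

variable [Finite V]

theorem minimalPeriod_zigzagStep (hσ : σ.Involutive) (hτ : τ.Involutive) (a : V) :
    Function.minimalPeriod (zigzagStep σ τ) (a, false) = 2 * (zigzagLength σ τ a + 1) := by
  have hpos := Function.minimalPeriod_pos_of_mem_periodicPts
    ((zigzagStep_injective hσ hτ).mem_periodicPts (a, false))
  have hperiod := (iterate_zigzagStep (σ := σ) (τ := τ) a _).symm.trans
    (Function.iterate_minimalPeriod (f := zigzagStep σ τ) (x := (a, false)))
  have : Even (Function.minimalPeriod (zigzagStep σ τ) (a, false)) :=
    Nat.not_odd_iff_even.1 (of_decide_eq_false (congrArg Prod.snd hperiod))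
  rw [zigzagLength]
  grind

theorem flip_iterate_zigzagStep (hσ : σ.Involutive) (hτ : τ.Involutive) (ha : σ a = a) {n : ℕ}
    (hn : n < 2 * (zigzagLength σ τ a + 1)) :
    Prod.map id not ((zigzagStep σ τ)^[n] (a, false)) =
      (zigzagStep σ τ)^[2 * (zigzagLength σ τ a + 1) - 1 - n] (a, false) := by
  have hinj := zigzagStep_injective hσ hτ
  have hperiod := Function.iterate_minimalPeriod (f := zigzagStep σ τ) (x := (a, false))
  rw [minimalPeriod_zigzagStep hσ hτ] at hperiod
  have hlast : Prod.map id not (a, false) =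
      (zigzagStep σ τ)^[2 * (zigzagLength σ τ a + 1) - 1] (a, false) := by
    apply hinj
    rw [← Function.iterate_succ_apply' (zigzagStep σ τ), Nat.succ_eq_add_one,
      Nat.sub_add_cancel (by omega), hperiod]
    simp [zigzagStep, ha]
  apply hinj.iterate n
  rw [iterate_zigzagStep_flip hσ hτ, hlast, ← Function.iterate_add_apply]
  congr 1
  omega

theorem zigzag_injOn (hσ : σ.Involutive) (hτ : τ.Involutive) (ha : σ a = a) :
    Set.InjOn (zigzag σ τ a) (Set.Iic (zigzagLength σ τ a)) := by
  have hinj := Function.iterate_injOn_Iio_minimalPeriod (f := zigzagStep σ τ) (x := (a, false))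
  rw [minimalPeriod_zigzagStep hσ hτ] at hinj
  intro i hi j hj hij
  rw [Set.mem_Iic] at hi hj
  by_cases hparity : Odd i ↔ Odd j
  · refine hinj (Set.mem_Iio.2 (by omega)) (Set.mem_Iio.2 (by omega)) ?_
    simp only [iterate_zigzagStep, hij, hparity]
  · have hflip : (zigzagStep σ τ)^[i] (a, false) =
        Prod.map id not ((zigzagStep σ τ)^[j] (a, false)) := by
      simp only [iterate_zigzagStep, hij, Prod.map_apply, id_eq, ← decide_not]
      grind
    rw [flip_iterate_zigzagStep hσ hτ ha (by omega)] at hflip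
    have := hinj (Set.mem_Iio.2 (by omega)) (Set.mem_Iio.2 (by omega)) hflip
    omega

theorem zigzag_succ_ne (hσ : σ.Involutive) (hτ : τ.Involutive) (ha : σ a = a) {k : ℕ}
    (hk : k < zigzagLength σ τ a) : zigzag σ τ a (k + 1) ≠ zigzag σ τ a k := fun h =>
  k.succ_ne_self (zigzag_injOn hσ hτ ha (Set.mem_Iic.2 hk) (Set.mem_Iic.2 hk.le) h)

theorem zigzag_zigzagLength_add_one (hσ : σ.Involutive) (hτ : τ.Involutive) (ha : σ a = a) :
    zigzag σ τ a (zigzagLength σ τ a + 1) = zigzag σ τ a (zigzagLength σ τ a) := by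
  have hflip := flip_iterate_zigzagStep hσ hτ ha (n := zigzagLength σ τ a) (by omega)
  rw [show 2 * (zigzagLength σ τ a + 1) - 1 - zigzagLength σ τ a = zigzagLength σ τ a + 1 by
    omega] at hflip
  exact (congrArg Prod.fst hflip).symm

theorem eq_of_zigzag_zigzagLength_eq (hσ : σ.Involutive) (hτ : τ.Involutive)
    (ha : Even (zigzagLength σ τ a)) (hb : Even (zigzagLength σ τ b))
    (h : zigzag σ τ a (zigzagLength σ τ a) = zigzag σ τ b (zigzagLength σ τ b)) : a = b := by
  have hinj := zigzagStep_injective hσ hτ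
  have hstate : (zigzagStep σ τ)^[zigzagLength σ τ a] (a, false) =
      (zigzagStep σ τ)^[zigzagLength σ τ b] (b, false) := by
    simp only [iterate_zigzagStep, h, Nat.not_odd_iff_even.2 ha, Nat.not_odd_iff_even.2 hb]
  have hlength : zigzagLength σ τ a = zigzagLength σ τ b := by
    have hperiod := congrArg (Function.minimalPeriod (zigzagStep σ τ)) hstate
    rw [Function.minimalPeriod_apply_iterate (hinj.mem_periodicPts _),
      Function.minimalPeriod_apply_iterate (hinj.mem_periodicPts _),
      minimalPeriod_zigzagStep hσ hτ, minimalPeriod_zigzagStep hσ hτ] at hperiod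
    omega
  rw [hlength] at hstate
  exact congrArg Prod.fst (hinj.iterate _ hstate)

theorem exists_zigzag_zigzagLength_notMem (hσ : σ.Involutive) (hτ : τ.Involutive) {A B : Set V}
    (hcard : B.ncard < A.ncard) :
    ∃ a ∈ A, Even (zigzagLength σ τ a) → zigzag σ τ a (zigzagLength σ τ a) ∉ B := by
  by_contra! hcon
  refine hcard.not_ge (Set.ncard_le_ncard_of_injOn (fun a => zigzag σ τ a (zigzagLength σ τ a))
    (fun a ha => (hcon a ha).2) (fun a ha b hb h => ?_) B.toFinite)
  exact eq_of_zigzag_zigzagLength_eq hσ hτ (hcon a ha).1 (hcon b hb).1 h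

end Zigzag

section Rounding

variable {V : Type*} [Fintype V] [DecidableEq V] {G : SimpleGraph V} [DecidableRel G.Adj]
  {x z w : G.edgeSet → ℝ} {y : V → ℝ} {C : Finset (Sym2 V)} {v : V} {e : G.edgeSet}

/-- The integral matching `z` arises from `x` by rounding on each odd cycle of `x`, so that exactly
one vertex of each of these cycles is left without an incident edge of `z`. -/
structure IsRounding (x z : G.edgeSet → ℝ) : Prop where
  mem_fractionalMatchings : z ∈ fractionalMatchings G
  zero_or_one : ∀ e, z e = 0 ∨ z e = 1
  eq_of_notMem : ∀ e : G.edgeSet, (∀ C ∈ oddCycles x, (e : Sym2 V) ∉ C) → z e = x e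
  existsUnique_load_eq_zero : ∀ C ∈ oddCycles x, ∃! v, v ∈ cycleVertices C ∧ load z v = 0

theorem load_congr (h : ∀ e : G.edgeSet, v ∈ (e : Sym2 V) → x e = z e) : load x v = load z v := by
  rw [load_apply, load_apply]
  exact Finset.sum_congr rfl fun e he => h e (Finset.mem_filter_univ e |>.1 he)

theorem IsRounding.load_eq (hz : IsRounding x z)
    (hv : ∀ C ∈ oddCycles x, v ∉ cycleVertices C) : load z v = load x v :=
  load_congr fun e he => hz.eq_of_notMem e fun C hC heC => hv C hC ⟨e, heC, he⟩

theorem IsRounding.eq_one (hz : IsRounding x z) (he : x e = 1) : z e = 1 := by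
  rw [hz.eq_of_notMem e fun C hC heC => ?_, he]
  have hhalf := hC.2.2 e heC
  rw [he] at hhalf
  norm_num at hhalf

theorem IsRounding.ne_zero (hz : IsRounding x z) (he : z e ≠ 0) : x e ≠ 0 := by
  by_cases h : ∃ C ∈ oddCycles x, (e : Sym2 V) ∈ C
  · obtain ⟨C, hC, heC⟩ := h
    rw [hC.2.2 e heC]
    norm_num
  · push Not at h
    rwa [← hz.eq_of_notMem e h]

theorem IsRounding.of_alternateRound {c : G.Walk v v} (hx : x ∈ fractionalMatchings G)
    (hC : C ∈ oddCycles x) (hc : Traverses c C) (hz : IsRounding (alternateRound c x) z) :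
    IsRounding x z := by
  have hcycles := oddCycles_alternateRound hx hC hc
  refine ⟨hz.1, hz.2, fun e he => ?_, fun D hD => ?_⟩
  · rw [hz.eq_of_notMem e fun D hD => he D (hcycles ▸ hD).1, alternateRound_of_notMem hc (he C hC)]
  · obtain rfl | hDC := eq_or_ne D C
    · have hload : ∀ u ∈ cycleVertices D, load z u = if u = v then 0 else 1 := fun u hu => by
        rw [hz.load_eq, load_alternateRound hx hC hc, load_eq_one_of_mem_oddCycles hx hC hu]
        rw [hcycles]
        exact fun E hE huE => hE.2 (eq_of_mem_oddCycles hx hE.1 hC huE hu)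
      refine ⟨v, ⟨hc.mem_cycleVertices, by rw [hload v hc.mem_cycleVertices, if_pos rfl]⟩, ?_⟩
      rintro u ⟨hu, hu0⟩
      by_contra huv
      rw [hload u hu, if_neg huv] at hu0
      exact one_ne_zero hu0
    · exact hz.existsUnique_load_eq_zero D (hcycles ▸ ⟨hD, hDC⟩)

theorem IsOddCycleMatching.exists_isRounding (hx : IsOddCycleMatching x) :
    ∃ z, IsRounding x z := by
  induction hn : (oddCycles x).ncard generalizing x with
  | zero =>
    have hempty : oddCycles x = ∅ := (Set.ncard_eq_zero (Set.toFinite _)).1 hn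
    exact ⟨x, hx.1, fun e => by simpa [hempty] using hx.2 e, fun _ _ => rfl, by simp [hempty]⟩
  | succ n ih =>
    obtain ⟨C, hC⟩ : (oddCycles x).Nonempty := Set.nonempty_of_ncard_ne_zero (by omega)
    obtain ⟨v, c, hc⟩ := hC.1
    obtain ⟨z, hz⟩ := ih (hx.alternateRound hC hc) (by
      rw [oddCycles_alternateRound hx.1 hC hc, Set.ncard_sdiff_singleton_of_mem hC, hn,
        Nat.add_sub_cancel])
    exact ⟨z, hz.of_alternateRound hx.1 hC hc⟩

theorem IsRounding.exists_mem_cycleVertices (hz : IsRounding x z) (hs : Slack w x y)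
    (hv : load z v = 0) (hy : y v ≠ 0) : ∃ C ∈ oddCycles x, v ∈ cycleVertices C := by
  by_contra! hoff
  have hone := hs.2 v hy
  rw [← hz.load_eq hoff, hv] at hone
  exact zero_ne_one hone

theorem IsRounding.ncard_le_ncard_oddCycles (hz : IsRounding x z) (hs : Slack w x y) :
    {v | load z v = 0 ∧ y v ≠ 0}.ncard ≤ (oddCycles x).ncard := by
  choose! C hC hvC using fun v (hv : load z v = 0 ∧ y v ≠ 0) =>
    hz.exists_mem_cycleVertices hs hv.1 hv.2
  refine Set.ncard_le_ncard_of_injOn C hC (fun u hu v hv huv => ?_) (Set.toFinite _)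
  exact (hz.existsUnique_load_eq_zero (C u) (hC u hu)).unique ⟨hvC u hu, hu.1⟩
    ⟨huv ▸ hvC v hv, hv.1⟩

theorem IsRounding.ncard_oddCycles_le_ncard (hx : x ∈ fractionalMatchings G) (hz : IsRounding x z)
    (hy : ∀ C v, ¬ZeroOnCycle x y C v) :
    (oddCycles x).ncard ≤ {v | load z v = 0 ∧ y v ≠ 0}.ncard := by
  choose r hr using fun C : oddCycles x => (hz.existsUnique_load_eq_zero C C.2).exists
  rw [← Nat.card_coe_set_eq]
  have hinj : Function.Injective r := fun C D h =>
    Subtype.ext (eq_of_mem_oddCycles hx C.2 D.2 (hr C).1 (h ▸ (hr D).1))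
  rw [← Set.ncard_range_of_injective hinj]
  refine Set.ncard_le_ncard (Set.range_subset_iff.2 fun C => ?_)
  exact ⟨(hr C).2, fun hyr => hy C (r C) ⟨C.2, (hr C).1, hyr⟩⟩

end Rounding

section Partner

variable {V : Type*} {G : SimpleGraph V} {z : G.edgeSet → ℝ} {u v : V}

theorem adj_of_extendZero_ne_zero (h : extendZero z s(u, v) ≠ 0) : G.Adj u v := by
  by_contra hadj
  exact h (Function.extend_apply' _ _ _ fun ⟨e, he⟩ =>
    hadj (G.mem_edgeSet.1 (he ▸ e.2)))

open Classical in
/-- The other end of the edge of value `1` at `v`, or `v` itself if there is no such edge. -/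
noncomputable def partner (z : G.edgeSet → ℝ) (v : V) : V :=
  if h : ∃ u, extendZero z s(v, u) = 1 then h.choose else v

theorem extendZero_partner (hv : partner z v ≠ v) : extendZero z s(v, partner z v) = 1 := by
  by_cases h : ∃ u, extendZero z s(v, u) = 1
  · rw [partner, dif_pos h]
    exact h.choose_spec
  · exact absurd (dif_neg h) hv

variable [Fintype V] [DecidableEq V] [DecidableRel G.Adj]

theorem partner_eq (hz : z ∈ fractionalMatchings G) (h : extendZero z s(v, u) = 1) :
    partner z v = u := by
  have hex : ∃ u, extendZero z s(v, u) = 1 := ⟨u, h⟩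
  rw [partner, dif_pos hex]
  have hspec := hex.choose_spec
  have hadj := adj_of_extendZero_ne_zero (h.trans_ne one_ne_zero)
  have hadj' := adj_of_extendZero_ne_zero (hspec.trans_ne one_ne_zero)
  rw [extendZero_mk z hadj] at h
  rw [extendZero_mk z hadj'] at hspec
  by_contra hne
  have hzero : z ⟨s(v, hex.choose), hadj'⟩ = 0 := eq_zero_of_eq_one hz h
    (fun hedge => hne (Sym2.congr_right.1 (congrArg Subtype.val hedge)))
    (Sym2.mem_mk_left _ _) (Sym2.mem_mk_left _ _)
  exact zero_ne_one (hzero.symm.trans hspec)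

theorem partner_involutive (hz : z ∈ fractionalMatchings G) : (partner z).Involutive := by
  intro v
  by_cases hv : partner z v = v
  · rw [hv, hv]
  · exact partner_eq hz (Sym2.eq_swap ▸ extendZero_partner hv)

theorem partner_eq_self_iff (hz : z ∈ fractionalMatchings G) (h01 : ∀ e, z e = 0 ∨ z e = 1) :
    partner z v = v ↔ load z v = 0 := by
  constructor
  · intro hv
    rw [load_apply]
    refine Finset.sum_eq_zero fun e hve => (h01 e).resolve_right fun he => ?_
    rw [Finset.mem_filter_univ] at hve
    obtain ⟨e, heG⟩ := e
    obtain ⟨u, rfl⟩ : v ∈ e := hve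
    rw [← extendZero_mk z heG] at he
    exact G.ne_of_adj heG (hv.symm.trans (partner_eq hz he))
  · intro hv
    by_contra hne
    have hone := extendZero_partner hne
    rw [extendZero_mk z (adj_of_extendZero_ne_zero (hone.trans_ne one_ne_zero))] at hone
    rw [load_eq_one_of_eq_one hz hone (Sym2.mem_mk_left _ _)] at hv
    exact one_ne_zero hv

end Partner

section AlternatingSequences

variable {V : Type*} {G : SimpleGraph V} {s : ℕ → V} {n : ℕ}

theorem exists_walk_of_adj (h : ∀ k < n, G.Adj (s k) (s (k + 1))) :
    ∃ p : G.Walk (s 0) (s n), p.length = n ∧ ∀ k ≤ n, p.getVert k = s k := by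
  induction n generalizing s with
  | zero => exact ⟨.nil, rfl, fun k hk => by rw [Nat.le_zero.1 hk, SimpleGraph.Walk.getVert_nil]⟩
  | succ n ih =>
    obtain ⟨p, hp, hps⟩ := ih (s := fun k => s (k + 1)) fun k hk => h (k + 1) (by omega)
    refine ⟨p.cons (h 0 n.succ_pos), by rw [SimpleGraph.Walk.length_cons, hp], fun k hk => ?_⟩
    cases k with
    | zero => exact SimpleGraph.Walk.getVert_zero _
    | succ k => rw [SimpleGraph.Walk.getVert_cons_succ, hps k (by omega)]

theorem exists_path_of_injOn (hs : Set.InjOn s (Set.Iic n))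
    (h : ∀ k < n, G.Adj (s k) (s (k + 1))) :
    ∃ p : G.Walk (s 0) (s n), p.IsPath ∧ p.edges.length = n ∧
      ∀ k (hk : k < p.edges.length), p.edges[k] = s(s k, s (k + 1)) := by
  obtain ⟨p, hp, hps⟩ := exists_walk_of_adj h
  refine ⟨p, ?_, by rw [SimpleGraph.Walk.length_edges, hp], fun k hk => ?_⟩
  · rw [← SimpleGraph.Walk.IsPath.getVert_injOn_iff, hp]
    exact hs.congr fun k hk => (hps k hk).symm
  · rw [SimpleGraph.Walk.length_edges, hp] at hk
    rw [SimpleGraph.Walk.getElem_edges, hps k hk.le, hps (k + 1) hk]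

theorem exists_alternating_tight_path {w : G.edgeSet → ℝ} {y : V → ℝ} {M : Set (Sym2 V)}
    (hs : Set.InjOn s (Set.Iic n))
    (htight : ∀ k < n, ∃ h : G.Adj (s k) (s (k + 1)),
      edgeSum y s(s k, s (k + 1)) = w ⟨s(s k, s (k + 1)), h⟩)
    (hM : ∀ k < n, s(s k, s (k + 1)) ∈ M ↔ Odd k) :
    ∃ p : G.Walk (s 0) (s n), p.IsPath ∧ Alternating M p ∧ Tight w y p ∧
      (0 < n → Even n → ∃ e ∈ p.edges.getLast?, e ∈ M) := by
  obtain ⟨p, hpath, hlen, hedge⟩ := exists_path_of_injOn hs fun k hk => (htight k hk).1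
  refine ⟨p, hpath, ?_, fun a b hab he => ?_, fun hpos heven => ?_⟩
  · rw [Alternating, List.isChain_iff_getElem]
    intro k hk
    rw [hedge, hedge, hM k (by omega), hM (k + 1) (by omega), Nat.odd_add_one, not_not]
  · obtain ⟨k, hk, hke⟩ := List.mem_iff_getElem.1 he
    rw [hedge k hk] at hke
    obtain ⟨hadj, htight⟩ := htight k (by omega)
    exact (congrArg (edgeSum y) hke).symm.trans (htight.trans (congrArg w (Subtype.ext hke)))
  · have hlast : n - 1 < p.edges.length := by omega
    refine ⟨p.edges[n - 1], ?_, ?_⟩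
    · rw [List.getLast?_eq_getElem?, hlen, List.getElem?_eq_getElem hlast]
      rfl
    · rw [hedge, hM _ (by omega)]
      exact Nat.Even.sub_odd hpos heven odd_one

end AlternatingSequences

section ExchangeSequences

variable {V : Type*} [Fintype V] [DecidableEq V] {G : SimpleGraph V} [DecidableRel G.Adj]
  {x w : G.edgeSet → ℝ} {y : V → ℝ} {C : Finset (Sym2 V)} {s : ℕ → V} {L i j : ℕ}

/-- One of the three structures along which `x` can be exchanged for a fractional matching with
fewer odd cycles. -/
def HasExchange (w x : G.edgeSet → ℝ) (y : V → ℝ) : Prop :=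
    (∃ C v, ZeroOnCycle x y C v) ∨
      (∃ (C D : Finset (Sym2 V)) (u v : V) (P : G.Walk u v), CycleToCycle w x y C D P) ∨
      (∃ (C : Finset (Sym2 V)) (u v : V) (P : G.Walk u v), CycleToZero w x y C P)

/-- A sequence `s 0, …, s L` of distinct vertices along tight edges which starts on the odd cycle
`C` and whose edges are alternately unmatched and in the support of `x`, so that it may still run
through edges of the odd cycles of `x`. A segment of it is one of the paths of `HasExchange`,
unless `s L` is a vertex of `C` with `y (s L) = 0`. -/
structure IsExchangeSequence (w x : G.edgeSet → ℝ) (y : V → ℝ) (C : Finset (Sym2 V)) (s : ℕ → V)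
    (L : ℕ) : Prop where
  injOn : Set.InjOn s (Set.Iic L)
  tight : ∀ k < L, ∃ h : G.Adj (s k) (s (k + 1)),
    edgeSum y s(s k, s (k + 1)) = w ⟨s(s k, s (k + 1)), h⟩
  notMem_matchedEdges : ∀ k < L, Even k → s(s k, s (k + 1)) ∉ matchedEdges x
  ne_zero : ∀ k < L, Odd k → extendZero x s(s k, s (k + 1)) ≠ 0
  mem_oddCycles : C ∈ oddCycles x
  start_mem : s 0 ∈ cycleVertices C
  end_eq_zero : Even L → y (s L) = 0
  end_notMem : Odd L → s L ∉ cycleVertices C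
  load_end : Odd L → (∀ D ∈ oddCycles x, s L ∉ cycleVertices D) → load x (s L) = 0

namespace IsExchangeSequence

theorem mem_succ_of_odd (h : IsExchangeSequence w x y C s L) (hx : x ∈ fractionalMatchings G)
    (hi : i < L) (hodd : Odd i) (hiC : s i ∈ cycleVertices C) : s (i + 1) ∈ cycleVertices C := by
  have hne := h.ne_zero i hi hodd
  have hadj := adj_of_extendZero_ne_zero hne
  rw [extendZero_mk x hadj] at hne
  exact ⟨_, mem_of_mem_oddCycles hx h.mem_oddCycles hiC (Sym2.mem_mk_left _ _) hne,
    Sym2.mem_mk_right _ _⟩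

theorem exists_last (h : IsExchangeSequence w x y C s L) (hx : x ∈ fractionalMatchings G) :
    ∃ i ≤ L, Even i ∧ s i ∈ cycleVertices C ∧ ∀ k, i < k → k ≤ L → s k ∉ cycleVertices C := by
  classical
  set i := Nat.findGreatest (fun k => s k ∈ cycleVertices C) L
  have hiL : i ≤ L := Nat.findGreatest_le L
  have hiC : s i ∈ cycleVertices C :=
    Nat.findGreatest_spec (P := fun k => s k ∈ cycleVertices C) L.zero_le h.start_mem
  have hlast : ∀ k, i < k → k ≤ L → s k ∉ cycleVertices C := fun k =>
    Nat.findGreatest_is_greatest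
  refine ⟨i, hiL, Nat.not_odd_iff_even.1 fun hodd => ?_, hiC, hlast⟩
  obtain hi | hi := hiL.eq_or_lt
  · exact h.end_notMem (hi ▸ hodd) (hi ▸ hiC)
  · exact hlast (i + 1) i.lt_succ_self hi (h.mem_succ_of_odd hx hi hodd hiC)

theorem mem_matchedEdges (h : IsExchangeSequence w x y C s L) (hx : IsOddCycleMatching x)
    (hi : i < L) (hodd : Odd i) (hoff : ∀ D ∈ oddCycles x, s i ∉ cycleVertices D) :
    s(s i, s (i + 1)) ∈ matchedEdges x := by
  have hne := h.ne_zero i hi hodd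
  have hadj := adj_of_extendZero_ne_zero hne
  rw [extendZero_mk x hadj] at hne
  obtain hzero | hone | ⟨D, hD, heD⟩ := hx.2 ⟨s(s i, s (i + 1)), hadj⟩
  · exact absurd hzero hne
  · exact ⟨hadj, hone⟩
  · exact absurd ⟨_, heD, Sym2.mem_mk_left _ _⟩ (hoff D hD)

theorem exists_path (h : IsExchangeSequence w x y C s L) (hx : IsOddCycleMatching x) (hij : i ≤ j)
    (hj : j ≤ L) (hi : Even i)
    (hoff : ∀ k, i < k → k < j → ∀ D ∈ oddCycles x, s k ∉ cycleVertices D) :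
    ∃ p : G.Walk (s i) (s j), p.IsPath ∧ Alternating (matchedEdges x) p ∧ Tight w y p ∧
      (i < j → Even j → ∃ e ∈ p.edges.getLast?, e ∈ matchedEdges x) := by
  obtain ⟨n, rfl⟩ := Nat.exists_eq_add_of_le hij
  have hparity : ∀ k, Odd (i + k) ↔ Odd k := fun k => by grind
  have hM : ∀ k < n, s(s (i + k), s (i + (k + 1))) ∈ matchedEdges x ↔ Odd k := fun k hk => by
    obtain hk' | hk' := Nat.even_or_odd (i + k)
    · exact iff_of_false (h.notMem_matchedEdges _ (by omega) hk') (by grind)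
    · exact iff_of_true (h.mem_matchedEdges hx (by omega) hk' (hoff _ (by grind) (by omega)))
        ((hparity k).1 hk')
  obtain ⟨p, hp, halt, htight, hlast⟩ := exists_alternating_tight_path
    (s := fun k => s (i + k)) (n := n)
    (fun k hk l hl hkl => Nat.add_left_cancel (h.injOn (Set.mem_Iic.2 (by grind))
      (Set.mem_Iic.2 (by grind)) hkl))
    (fun k hk => h.tight (i + k) (by omega)) hM
  exact ⟨p, hp, halt, htight, fun hin heven => hlast (by omega) (by grind)⟩

theorem exists_cycleToZero (h : IsExchangeSequence w x y C s L) (hx : IsOddCycleMatching x)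
    (hs : Slack w x y) (hi : i < L) (heven : Even i) (hiC : s i ∈ cycleVertices C)
    (hoff : ∀ k, i < k → k ≤ L → ∀ D ∈ oddCycles x, s k ∉ cycleVertices D) :
    ∃ P : G.Walk (s i) (s L), CycleToZero w x y C P := by
  obtain ⟨P, hP, halt, htight, hlast⟩ :=
    h.exists_path hx hi.le le_rfl heven fun k hik hk => hoff k hik hk.le
  have hC := h.mem_oddCycles
  have hLoff := hoff L hi le_rfl
  have hy : y (s L) = 0 := by
    obtain hL | hL := Nat.even_or_odd L
    · exact h.end_eq_zero hL
    · exact not_not.1 fun hy => zero_ne_one ((h.load_end hL hLoff).symm.trans (hs.2 _ hy))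
  have hstart : Exposed (matchedEdges x) (s i) := by
    rintro e ⟨he, hone⟩ hie
    have hhalf := hC.2.2 ⟨e, he⟩
      (mem_of_mem_oddCycles (g := ⟨e, he⟩) hx.1 hC hiC hie (hone.trans_ne one_ne_zero))
    rw [hone] at hhalf
    norm_num at hhalf
  refine ⟨P, hC, hiC, hLoff, hy, hP, halt, ⟨.inl hstart, ?_⟩, htight⟩
  obtain hL | hL := Nat.even_or_odd L
  · exact .inr (hlast hi hL)
  · refine .inl ?_
    rintro e ⟨he, hone⟩ hLe
    have hzero := eq_zero_of_load_eq_zero (e := ⟨e, he⟩) hx.1 (h.load_end hL hLoff) hLe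
    exact zero_ne_one (hzero.symm.trans hone)

theorem hasExchange (h : IsExchangeSequence w x y C s L) (hx : IsOddCycleMatching x)
    (hs : Slack w x y) : HasExchange w x y := by
  classical
  obtain ⟨i, hiL, heven, hiC, hlast⟩ := h.exists_last hx.1
  by_cases hmeet : ∃ j, i < j ∧ j ≤ L ∧ ∃ D ∈ oddCycles x, s j ∈ cycleVertices D
  · obtain ⟨hij, hjL, D, hD, hjD⟩ := Nat.find_spec hmeet
    obtain ⟨P, hP, halt, htight, -⟩ := h.exists_path hx hij.le hjL heven fun k hik hkj E hE hkE =>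
      Nat.find_min hmeet hkj ⟨hik, by omega, E, hE, hkE⟩
    have hCD : C ≠ D := fun hCD => hlast _ hij hjL (hCD ▸ hjD)
    exact .inr (.inl ⟨C, D, _, _, P, h.mem_oddCycles, hD, hCD, hiC, hjD, hP, halt, htight⟩)
  · push Not at hmeet
    obtain rfl | hi := hiL.eq_or_lt
    · exact .inl ⟨C, s i, h.mem_oddCycles, hiC, h.end_eq_zero heven⟩
    · obtain ⟨P, hP⟩ := h.exists_cycleToZero hx hs hi heven hiC hmeet
      exact .inr (.inr ⟨C, _, _, P, hP⟩)

end IsExchangeSequence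

end ExchangeSequences

section Existence

variable {V : Type*} [Fintype V] [DecidableEq V] {G : SimpleGraph V} [DecidableRel G.Adj]
  {x x' z z' w : G.edgeSet → ℝ} {y : V → ℝ} {C : Finset (Sym2 V)} {a : V} {k : ℕ}

theorem extendZero_zigzag_partner_of_even (hz : z ∈ fractionalMatchings G)
    (hz' : z' ∈ fractionalMatchings G) (ha : partner z a = a)
    (hk : k < zigzagLength (partner z) (partner z') a) (heven : Even k) :
    extendZero z' s(zigzag (partner z) (partner z') a k,
      zigzag (partner z) (partner z') a (k + 1)) = 1 := by
  have hne := zigzag_succ_ne (partner_involutive hz) (partner_involutive hz') ha hk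
  rw [zigzag_succ_of_even heven] at hne ⊢
  exact extendZero_partner hne

theorem extendZero_zigzag_partner_of_odd (hz : z ∈ fractionalMatchings G)
    (hz' : z' ∈ fractionalMatchings G) (ha : partner z a = a)
    (hk : k < zigzagLength (partner z) (partner z') a) (hodd : Odd k) :
    extendZero z s(zigzag (partner z) (partner z') a k,
      zigzag (partner z) (partner z') a (k + 1)) = 1 := by
  have hne := zigzag_succ_ne (partner_involutive hz) (partner_involutive hz') ha hk
  rw [zigzag_succ_of_odd hodd] at hne ⊢
  exact extendZero_partner hne

theorem extendZero_zigzag_partner_ne_one_of_even (hz : z ∈ fractionalMatchings G)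
    (hz' : z' ∈ fractionalMatchings G) (ha : partner z a = a)
    (hk : k < zigzagLength (partner z) (partner z') a) (heven : Even k) :
    extendZero z s(zigzag (partner z) (partner z') a k,
      zigzag (partner z) (partner z') a (k + 1)) ≠ 1 := fun hone => by
  have hpartner := partner_eq hz hone
  cases k with
  | zero =>
    exact zigzag_succ_ne (partner_involutive hz) (partner_involutive hz') ha hk
      (hpartner.symm.trans ha)
  | succ k =>
    have hodd : Odd k := by grind
    rw [zigzag_succ_of_odd hodd, partner_involutive hz] at hpartner
    have := zigzag_injOn (partner_involutive hz) (partner_involutive hz') ha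
      (Set.mem_Iic.2 (by omega)) (Set.mem_Iic.2 hk) hpartner
    omega

theorem IsRounding.eq_one_of_mem_matchedEdges (hz : IsRounding x z) {e : Sym2 V}
    (he : e ∈ matchedEdges x) : extendZero z e = 1 := by
  obtain ⟨heG, hone⟩ := he
  rw [extendZero_mk z heG, hz.eq_one hone]

theorem IsRounding.extendZero_ne_zero (hz : IsRounding x z) {e : Sym2 V}
    (he : extendZero z e ≠ 0) : extendZero x e ≠ 0 := by
  obtain ⟨u, v⟩ := e
  have hadj := adj_of_extendZero_ne_zero he
  rw [extendZero_mk z hadj] at he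
  rw [extendZero_mk x hadj]
  exact hz.ne_zero he

theorem Slack.edgeSum_eq (hs : Slack w x y) {u v : V} (h : extendZero x s(u, v) ≠ 0) :
    ∃ hadj : G.Adj u v, edgeSum y s(u, v) = w ⟨s(u, v), hadj⟩ := by
  have hadj := adj_of_extendZero_ne_zero h
  rw [extendZero_mk x hadj] at h
  exact ⟨hadj, hs.1 _ h⟩

theorem isExchangeSequence_zigzag_partner (hz : IsRounding x z) (hz' : IsRounding x' z')
    (hs : Slack w x y) (hs' : Slack w x' y) (hC : C ∈ oddCycles x) (haC : a ∈ cycleVertices C)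
    (ha : load z a = 0)
    (hend : Even (zigzagLength (partner z) (partner z') a) →
      zigzag (partner z) (partner z') a (zigzagLength (partner z) (partner z') a) ∉
        {v | load z' v = 0 ∧ y v ≠ 0}) :
    IsExchangeSequence w x y C (zigzag (partner z) (partner z') a)
      (zigzagLength (partner z) (partner z') a) := by
  have hσ := partner_involutive hz.1
  have hτ := partner_involutive hz'.1
  have hfix := (partner_eq_self_iff hz.1 hz.2).2 ha
  have hlast := zigzag_zigzagLength_add_one hσ hτ hfix
  have hload : Odd (zigzagLength (partner z) (partner z') a) → load z
      (zigzag (partner z) (partner z') a (zigzagLength (partner z) (partner z') a)) = 0 :=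
    fun hodd => (partner_eq_self_iff hz.1 hz.2).1 ((zigzag_succ_of_odd hodd).symm.trans hlast)
  have heven : ∀ k < zigzagLength (partner z) (partner z') a, Even k → extendZero x'
      s(zigzag (partner z) (partner z') a k, zigzag (partner z) (partner z') a (k + 1)) ≠ 0 :=
    fun k hk heven => hz'.extendZero_ne_zero <|
      (extendZero_zigzag_partner_of_even hz.1 hz'.1 hfix hk heven).trans_ne one_ne_zero
  have hodd : ∀ k < zigzagLength (partner z) (partner z') a, Odd k → extendZero x
      s(zigzag (partner z) (partner z') a k, zigzag (partner z) (partner z') a (k + 1)) ≠ 0 :=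
    fun k hk hodd => hz.extendZero_ne_zero <|
      (extendZero_zigzag_partner_of_odd hz.1 hz'.1 hfix hk hodd).trans_ne one_ne_zero
  refine ⟨zigzag_injOn hσ hτ hfix, fun k hk => ?_, fun k hk heven hmatched => ?_, hodd, hC, haC,
    fun heven => ?_, fun hodd hLC => ?_, fun hodd hoff => hz.load_eq hoff ▸ hload hodd⟩
  · exact (Nat.even_or_odd k).elim (fun h => hs'.edgeSum_eq (heven k hk h))
      fun h => hs.edgeSum_eq (hodd k hk h)
  · exact extendZero_zigzag_partner_ne_one_of_even hz.1 hz'.1 hfix hk heven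
      (hz.eq_one_of_mem_matchedEdges hmatched)
  · by_contra hy
    exact hend heven ⟨(partner_eq_self_iff hz'.1 hz'.2).1
      ((zigzag_succ_of_even heven).symm.trans hlast), hy⟩
  · have hLa := (hz.existsUnique_load_eq_zero C hC).unique ⟨hLC, hload hodd⟩ ⟨haC, ha⟩
    have hL := zigzag_injOn hσ hτ hfix (Set.mem_Iic.2 le_rfl) (Set.mem_Iic.2 (Nat.zero_le _)) hLa
    exact Nat.not_odd_zero (hL ▸ hodd)

theorem exists_basicMax_ncard_oddCycles_eq_gamma (hx : x ∈ basicMaxFractionalMatchings G w) :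
    ∃ x' ∈ basicMaxFractionalMatchings G w, (oddCycles x').ncard = gamma G w :=
  Nat.sInf_mem (Set.Nonempty.image _ ⟨x, hx⟩)

theorem hasExchange_of_gamma_lt (hx : x ∈ basicMaxFractionalMatchings G w)
    (hy : y ∈ minFractionalCovers G w) (hγ : gamma G w < (oddCycles x).ncard) :
    HasExchange w x y := by
  by_cases hzero : ∃ C v, ZeroOnCycle x y C v
  · exact .inl hzero
  push Not at hzero
  obtain ⟨x', hx', hx'γ⟩ := exists_basicMax_ncard_oddCycles_eq_gamma hx
  have hs := slack_of_optimal hx.2 hy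
  have hs' := slack_of_optimal hx'.2 hy
  have hxc := mem_extremePoints_iff_isOddCycleMatching.1 hx.1
  obtain ⟨z, hz⟩ := hxc.exists_isRounding
  obtain ⟨z', hz'⟩ := (mem_extremePoints_iff_isOddCycleMatching.1 hx'.1).exists_isRounding
  have hcard : {v | load z' v = 0 ∧ y v ≠ 0}.ncard < {v | load z v = 0 ∧ y v ≠ 0}.ncard :=
    calc {v | load z' v = 0 ∧ y v ≠ 0}.ncard
      _ ≤ (oddCycles x').ncard := hz'.ncard_le_ncard_oddCycles hs'
      _ < (oddCycles x).ncard := hx'γ.trans_lt hγ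
      _ ≤ {v | load z v = 0 ∧ y v ≠ 0}.ncard := hz.ncard_oddCycles_le_ncard hxc.1 hzero
  obtain ⟨a, ⟨ha, hya⟩, hend⟩ := exists_zigzag_zigzagLength_notMem (partner_involutive hz.1)
    (partner_involutive hz'.1) hcard
  obtain ⟨C, hC, haC⟩ := hz.exists_mem_cycleVertices hs ha hya
  exact (isExchangeSequence_zigzag_partner hz hz' hs hs' hC haC ha hend).hasExchange hxc hs

end Existence

end FractionalMatching

theorem mainTheorem3_general {V : Type*} [Fintype V] [DecidableEq V] (G : SimpleGraph V)
    [DecidableRel G.Adj] (w : G.edgeSet → ℝ)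
    (x : G.edgeSet → ℝ) (hx : x ∈ basicMaxFractionalMatchings G w)
    (y : V → ℝ) (hy : y ∈ minFractionalCovers G w) :
    (gamma G w < (oddCycles x).ncard →
      (∃ C v, ZeroOnCycle x y C v) ∨
      (∃ (C D : Finset (Sym2 V)) (u v : V) (P : G.Walk u v), CycleToCycle w x y C D P) ∨
      (∃ (C : Finset (Sym2 V)) (u v : V) (P : G.Walk u v), CycleToZero w x y C P)) ∧
    (∀ (C : Finset (Sym2 V)) (v : V), ZeroOnCycle x y C v →
      ∀ c : G.Walk v v, Traverses c C →
        alternateRound c x ∈ basicMaxFractionalMatchings G w ∧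
        oddCycles (alternateRound c x) ⊂ oddCycles x) ∧
    (∀ (C D : Finset (Sym2 V)) (u v : V) (P : G.Walk u v), CycleToCycle w x y C D P →
      ∀ (c : G.Walk u u) (d : G.Walk v v), Traverses c C → Traverses d D →
        complementOn P (alternateRound d (alternateRound c x)) ∈
          basicMaxFractionalMatchings G w ∧
        oddCycles (complementOn P (alternateRound d (alternateRound c x))) ⊂ oddCycles x) ∧
    (∀ (C : Finset (Sym2 V)) (u v : V) (P : G.Walk u v), CycleToZero w x y C P →
      ∀ c : G.Walk u u, Traverses c C →
        complementOn P (alternateRound c x) ∈ basicMaxFractionalMatchings G w ∧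
        oddCycles (complementOn P (alternateRound c x)) ⊂ oddCycles x) := by
  have hs := slack_of_optimal hx.2 hy
  have hxc := mem_extremePoints_iff_isOddCycleMatching.1 hx.1
  exact ⟨hasExchange_of_gamma_lt hx hy,
    fun _ _ h _ hc => round_zeroOnCycle hxc hy.1 hs h hc,
    fun _ _ _ _ _ h _ _ hc hd => round_cycleToCycle hxc hy.1 hs h hc hd,
    fun _ _ _ _ h _ hc => round_cycleToZero hxc hy.1 hs h hc⟩

theorem mainTheorem3 {V : Type*} [Fintype V] [DecidableEq V] (G : SimpleGraph V)
    [DecidableRel G.Adj] (w : G.edgeSet → ℝ) (hw : ∀ e, 0 ≤ w e)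
    (x : G.edgeSet → ℝ) (hx : x ∈ basicMaxFractionalMatchings G w)
    (y : V → ℝ) (hy : y ∈ minFractionalCovers G w) :
    (gamma G w < (oddCycles x).ncard →
      (∃ C v, ZeroOnCycle x y C v) ∨
      (∃ (C D : Finset (Sym2 V)) (u v : V) (P : G.Walk u v), CycleToCycle w x y C D P) ∨
      (∃ (C : Finset (Sym2 V)) (u v : V) (P : G.Walk u v), CycleToZero w x y C P)) ∧
    (∀ (C : Finset (Sym2 V)) (v : V), ZeroOnCycle x y C v →
      ∀ c : G.Walk v v, Traverses c C →
        alternateRound c x ∈ basicMaxFractionalMatchings G w ∧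
        oddCycles (alternateRound c x) ⊂ oddCycles x) ∧
    (∀ (C D : Finset (Sym2 V)) (u v : V) (P : G.Walk u v), CycleToCycle w x y C D P →
      ∀ (c : G.Walk u u) (d : G.Walk v v), Traverses c C → Traverses d D →
        complementOn P (alternateRound d (alternateRound c x)) ∈
          basicMaxFractionalMatchings G w ∧
        oddCycles (complementOn P (alternateRound d (alternateRound c x))) ⊂ oddCycles x) ∧
    (∀ (C : Finset (Sym2 V)) (u v : V) (P : G.Walk u v), CycleToZero w x y C P →
      ∀ c : G.Walk u u, Traverses c C →
        complementOn P (alternateRound c x) ∈ basicMaxFractionalMatchings G w ∧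
        oddCycles (complementOn P (alternateRound c x)) ⊂ oddCycles x) :=
  mainTheorem3_general G w x hx y hy
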